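/- **Setting.** Let $G=(V,\mathcal D,\mathcal B)$ be a mixed graph on a finite vertex set $V$: $\mathcal D\subseteq V\times V$ is the set of directed edges $i\to j$, and $\mathcal B$ is a set of unordered pairs of distinct vertices, the bidirected edges $i\leftrightarrow j$. Assume that $G$ is acyclic, i.e. $(V,\mathcal D)$ has no directed cycle. Let $\mathbb R^{\mathcal D}$ be the space of real $V\times V$ matrices $\Lambda=(\lambda_{ij})$ with $\lambda_{ij}=0$ whenever $i\to j\notin\mathcal D$, and let $PD(\mathcal B)$ be the cone of positive definite real $V\times V$ matrices $\Omega=(\omega_{ij})$ with $\omega_{ij}=0$ whenever $i\ne j$ and $i\leftrightarrow j\notin\mathcal B$. For $P,Q\subseteq V$, $\Lambda\in\mathbb R^{\mathcal D}$ and $\Omega\in PD(\mathcal B)$ let $$\Sigma^{(P,Q)}=\big[(I-\Lambda)_{P,P}\big]^{-T}\,\Omega_{P,Q}\,\big[(I-\Lambda)_{Q,Q}\big]^{-1},$$ and for $A\subseteq P$, $B\subseteq Q$ let $\Sigma^{(P,Q)}_{A,B}$ be its submatrix with row indices $A$ and column indices $B$. A *trek* from $i_\ell$ to $j_r$ ($\ell,r\ge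 1$) is a path $\tau$ of the form $i_\ell\leftarrow\cdots\leftarrow i_1\leftrightarrow j_1\to\cdots\to j_r$ or $i_\ell\leftarrow\cdots\leftarrow i_1=j_1\to\cdots\to j_r$; vertices may be repeated. Its left side is $\{i_1,\dots,i_\ell\}$, its right side is $\{j_1,\dots,j_r\}$, and its trek monomial is $\sigma(\tau)=\omega_{i_1j_1}\prod_{k=1}^{\ell-1}\lambda_{i_ki_{k+1}}\prod_{k=1}^{r-1}\lambda_{j_kj_{k+1}}$. The trek is *$(P,Q)$-restricted* if its left side lies in $P$ and its right side lies in $Q$. For $S_L,S_R\subseteq V$, the sets $A$ and $B$ are *$(P,Q)$-restricted trek-separated* by $(S_L,S_R)$ if every $(P,Q)$-restricted trek from a vertex of $A$ to a vertex of $B$ meets $S_L$ on its left side or $S_R$ on its right side. If $|A|=|B|$, a *system of treks* $\mathcal T$ from $A$ to $B$ is a set of treks from vertices of $A$ to vertices of $B$ in which each vertex of $A$ is the start of precisely one trek and each vertex of $B$ is the end of precisely one trek. It has *no sided intersection* if any two distinct treks in it have disjoint left sides and disjoint right sides. Fixing orderings of $A$ and $B$, let $(-1)^{\mathcal T}$ be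 the sign of the permutation that maps the $i$th element of $B$ to the end point of the trek starting at the $i$th element of $A$. **Theorem 4.3.** Let $G$ be an acyclic mixed graph, and let $A\subseteq P\subseteq V$ and $B\subseteq Q\subseteq V$. (i) For all $\Lambda\in\mathbb R^{\mathcal D}$ and $\Omega\in PD(\mathcal B)$, the rank of $\Sigma^{(P,Q)}_{A,B}$ is at most $$\min\{|S_L|+|S_R| : S_L,S_R\subseteq V,\ A\text{ and }B\text{ are }(P,Q)\text{-restricted trek-separated by }(S_L,S_R)\},$$ and it is equal to this minimum generically, that is, for all $(\Lambda,\Omega)\in\mathbb R^{\mathcal D}\times PD(\mathcal B)$ outside a proper algebraic subset of $\mathbb R^{\mathcal D}\times PD(\mathcal B)$. (ii) If $|A|=|B|$, then there are only finitely many systems of $(P,Q)$-restricted treks from $A$ to $B$ with no sided intersection, and for all $\Lambda\in\mathbb R^{\mathcal D}$, $\Omega\in PD(\mathcal B)$ and all orderings of $A$ and $B$, $$\det\Sigma^{(P,Q)}_{A,B}=\sum_{\mathcal T}(-1)^{\mathcal T}\prod_{\tau\in\mathcal T}\sigma(\tau),$$ where the sum runs over all these systems $\mathcal T$. -/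

import Mathlib

/-- A mixed graph on the vertex set `V`: directed edges `i → j` (written `dir i j`) and bidirected
edges `i ↔ j`, the latter being unordered pairs of distinct vertices. -/
structure MixedGraph (V : Type*) where
  dir : V → V → Prop
  bidir : SimpleGraph V

namespace MixedGraph

variable {V : Type*} (G : MixedGraph V)

/-- The directed part has no directed cycle (in particular no directed loop). -/
def Acyclic : Prop := ∀ v : V, ¬ Relation.TransGen G.dir v v

/-- The space `ℝ^𝒟` of real `V × V` matrices supported on the directed edges. -/
def lambdaSpace : Set (Matrix V V ℝ) := {Λ | ∀ i j, ¬ G.dir i j → Λ i j = 0}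

/-- The cone `PD(ℬ)` of positive definite `V × V` matrices whose off-diagonal entries are supported
on the bidirected edges. -/
def omegaSpace : Set (Matrix V V ℝ) :=
  {Ω | Ω.PosDef ∧ ∀ i j, i ≠ j → ¬ G.bidir.Adj i j → Ω i j = 0}

/-- A property of the parameters `(Λ, Ω) ∈ ℝ^𝒟 × PD(ℬ)` holds generically if it holds at every point
of this parameter space outside a proper algebraic subset of it: there is a polynomial in the matrix
entries that is not identically zero on the parameter space, and the property holds wherever this
polynomial is nonzero. -/
def Generically (p : Matrix V V ℝ → Matrix V V ℝ → Prop) : Prop :=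
  ∃ f : MvPolynomial ((V × V) ⊕ (V × V)) ℝ,
    (∃ Λ ∈ G.lambdaSpace, ∃ Ω ∈ G.omegaSpace,
      MvPolynomial.eval (Sum.elim (fun e => Λ e.1 e.2) (fun e => Ω e.1 e.2)) f ≠ 0) ∧
    ∀ Λ ∈ G.lambdaSpace, ∀ Ω ∈ G.omegaSpace,
      MvPolynomial.eval (Sum.elim (fun e => Λ e.1 e.2) (fun e => Ω e.1 e.2)) f ≠ 0 → p Λ Ω

/-- A directed path `v₁ → v₂ → ⋯ → vₖ`, `k ≥ 1`, given by its list of vertices. -/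
structure DirPath where
  verts : List V
  ne_nil : verts ≠ []
  chain : verts.IsChain G.dir

namespace DirPath

variable {G}

/-- The first vertex of a directed path. -/
def first (p : G.DirPath) : V := p.verts.head p.ne_nil

/-- The last vertex of a directed path. -/
def last (p : G.DirPath) : V := p.verts.getLast p.ne_nil

/-- The product of the `Λ i j` over the edges `i → j` of the path. -/
def weight (Λ : Matrix V V ℝ) (p : G.DirPath) : ℝ :=
  (List.zipWith (fun i j => Λ i j) p.verts p.verts.tail).prod

end DirPath

/-- A trek `i_ℓ ← ⋯ ← i₁ ↔ j₁ → ⋯ → j_r` or `i_ℓ ← ⋯ ← i₁ = j₁ → ⋯ → j_r`, `ℓ, r ≥ 1`. The left side is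
the directed path `i₁ → ⋯ → i_ℓ`, the right side is the directed path `j₁ → ⋯ → j_r`; in the second
case the common vertex `i₁ = j₁` lies on both sides. The two sides may share vertices. -/
structure Trek where
  left : G.DirPath
  right : G.DirPath
  top : left.first = right.first ∨ G.bidir.Adj left.first right.first

namespace Trek

variable {G}

/-- The vertex `i_ℓ` from which the trek starts. -/
def source (τ : G.Trek) : V := τ.left.last

/-- The vertex `j_r` at which the trek ends. -/
def target (τ : G.Trek) : V := τ.right.last

/-- The set of vertices on the left side. -/
def leftSide (τ : G.Trek) : Set V := {v | v ∈ τ.left.verts}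

/-- The set of vertices on the right side. -/
def rightSide (τ : G.Trek) : Set V := {v | v ∈ τ.right.verts}

/-- The trek monomial `ω_{i₁ j₁} ∏ λ_{i_k i_{k+1}} ∏ λ_{j_k j_{k+1}}`. -/
def monomial (Λ Ω : Matrix V V ℝ) (τ : G.Trek) : ℝ :=
  Ω τ.left.first τ.right.first * τ.left.weight Λ * τ.right.weight Λ

/-- The trek is `(P, Q)`-restricted: its left side lies in `P` and its right side lies in `Q`. -/
def Restricted (P Q : Finset V) (τ : G.Trek) : Prop :=
  τ.leftSide ⊆ (P : Set V) ∧ τ.rightSide ⊆ (Q : Set V)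

end Trek

/-- `A` and `B` are `(P, Q)`-restricted trek-separated by `(S_L, S_R)`: every `(P, Q)`-restricted trek
from a vertex of `A` to a vertex of `B` meets `S_L` on its left side or `S_R` on its right side. -/
def TrekSeparated (P Q A B SL SR : Finset V) : Prop :=
  ∀ τ : G.Trek, τ.Restricted P Q → τ.source ∈ A → τ.target ∈ B →
    (τ.leftSide ∩ (SL : Set V)).Nonempty ∨ (τ.rightSide ∩ (SR : Set V)).Nonempty

/-- A system of treks from `A` to `B` in which every vertex of `A` is the start of precisely one trek
and every vertex of `B` is the end of precisely one trek: `trek a` is the trek that starts at `a`, and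
`toEquiv` is the induced bijection from `A` to `B`. -/
structure TrekSystem (A B : Finset V) where
  toEquiv : A ≃ B
  trek : A → G.Trek
  source_eq : ∀ a, (trek a).source = a
  target_eq : ∀ a, (trek a).target = toEquiv a

namespace TrekSystem

variable {G} {A B : Finset V}

/-- Any two distinct treks of the system have disjoint left sides and disjoint right sides. -/
def NoSidedIntersection (T : G.TrekSystem A B) : Prop :=
  ∀ a b : A, a ≠ b →
    Disjoint (T.trek a).leftSide (T.trek b).leftSide ∧
      Disjoint (T.trek a).rightSide (T.trek b).rightSide

/-- The sign of the system for the orderings `α` of `A` and `β` of `B`: the sign of the permutation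
that maps `i` to the position of the end point of the trek starting at the `i`-th element of `A`. -/
def sign {n : ℕ} (α : Fin n ≃ A) (β : Fin n ≃ B) (T : G.TrekSystem A B) : ℤˣ :=
  Equiv.Perm.sign ((α.trans T.toEquiv).trans β.symm)

/-- The product of the trek monomials of the treks in the system. -/
def monomial (Λ Ω : Matrix V V ℝ) (T : G.TrekSystem A B) : ℝ :=
  ∏ a : A, (T.trek a).monomial Λ Ω

end TrekSystem

/-- The systems of `(P, Q)`-restricted treks from `A` to `B` with no sided intersection. -/
def restrictedSystems (P Q A B : Finset V) : Set (G.TrekSystem A B) :=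
  {T | (∀ a, (T.trek a).Restricted P Q) ∧ T.NoSidedIntersection}

/-- The matrix `[(I - Λ)_{P,P}]^{-T} Ω_{P,Q} [(I - Λ)_{Q,Q}]^{-1}`, with rows indexed by `P` and columns
indexed by `Q`. -/
noncomputable def restrictedSigma [DecidableEq V] (P Q : Finset V) (Λ Ω : Matrix V V ℝ) :
    Matrix P Q ℝ :=
  (((1 - Λ).submatrix (fun i : P => (i : V)) (fun j : P => (j : V)))⁻¹).transpose *
    Ω.submatrix (fun i : P => (i : V)) (fun j : Q => (j : V)) *
    ((1 - Λ).submatrix (fun i : Q => (i : V)) (fun j : Q => (j : V)))⁻¹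

/-- Its submatrix with row indices `A ⊆ P` and column indices `B ⊆ Q`. -/
noncomputable def restrictedSigmaSub [DecidableEq V] {P Q A B : Finset V} (hA : A ⊆ P) (hB : B ⊆ Q)
    (Λ Ω : Matrix V V ℝ) : Matrix A B ℝ :=
  (restrictedSigma P Q Λ Ω).submatrix (fun a : A => (⟨a, hA a.2⟩ : P)) (fun b : B => (⟨b, hB b.2⟩ : Q))

end MixedGraph

/-!
The matrix `[(I - Λ)_{P,P}]⁻¹`, extended by zero to `V × V`, is the *path matrix* `pathMatrix P Λ`: its
`(u, v)` entry is the sum of the weights of the directed paths from `u` to `v` inside `P`. Hence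
`Σ^{(P,Q)} = Z_Pᵀ Ω Z_Q` for the two path matrices, and its entries are sums of trek monomials. A height
function on the vertices makes `I - Λ` unitriangular, so that path matrices are polynomial in `Λ`.

*Determinants.* `alternating_eq_sum_disjointFamilies` is a one-sided Lindström–Gessel–Viennot lemma: an
alternating form evaluated at path sums is a sum over families of vertex-disjoint paths. It is proved by
deleting a sink rather than by a sign-reversing involution. Applied to the rows of `Σ^{(P,Q)}_{A,B}` it
produces the left sides, applied to the columns it produces the right sides, and the Leibniz expansion
of the remaining minor of `Ω` pairs them up to trek systems with no sided intersection.

*Upper bound on the rank.* Forbidding the vertices of `S_L` changes `Z_P` by a matrix of rank at most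
`|S_L|`, and likewise on the right. If `(S_L, S_R)` separates `A` from `B`, then the product of the two
changed path matrices with `Ω` vanishes on `A × B`, because a nonzero entry would give a trek that
avoids both sets.

*Generic rank.* Treks are the paths of an auxiliary graph on two copies of `V`. Hall's marriage theorem
gives Menger's theorem for it in the form of a perfect matching (`exists_linkage`), whence as many tops
as the size of a smallest separating pair, joined to `A` on the left and to `B` on the right by disjoint
paths (`exists_tops`). In the determinant formula monomials of different systems may coincide, as `Λ`
serves both sides and `Ω` is symmetric. Therefore the nonvanishing of the corresponding minor is shown
for `Ω = F Fᵀ`, where each column of `F` is supported on the two end points of one top: the minor is then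
the product of a left and a right factor. Each factor is a polynomial that is nonzero at some point, so
both are nonzero at a common point, and adding a small multiple of `I` makes `Ω` positive definite.
-/

namespace MixedGraph

/-! ### Path matrices -/

section PathMatrices

variable {V : Type*} [Fintype V] [DecidableEq V] {R S : Type*} [CommRing R] [CommRing S]

/-- In a finite acyclic mixed graph the vertices carry a height that increases along directed
edges. -/
lemma Acyclic.exists_height {V : Type*} [Fintype V] {G : MixedGraph V} (hG : G.Acyclic) :
    ∃ b : V → ℕ, ∀ i j, G.dir i j → b i < b j := by
  classical
  refine ⟨fun v => (Finset.univ.filter fun u => Relation.TransGen G.dir u v).card, fun i j hij => ?_⟩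
  refine Finset.card_lt_card (Finset.ssubset_iff_of_subset ?_ |>.2 ⟨i, ?_, ?_⟩)
  · intro u hu
    simp only [Finset.mem_filter, Finset.mem_univ, true_and] at hu ⊢
    exact hu.tail hij
  · simpa using Relation.TransGen.single hij
  · simpa using hG i

lemma lt_of_ne_zero {V : Type*} {G : MixedGraph V} {b : V → ℕ} (hb : ∀ i j, G.dir i j → b i < b j)
    {Λ : Matrix V V ℝ} (hΛ : Λ ∈ G.lambdaSpace) (i j : V) (hij : Λ i j ≠ 0) : b i < b j :=
  hb i j (by by_contra hd; exact hij (hΛ i j hd))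

lemma det_one_sub_eq_one {b : V → ℕ} {Λ : Matrix V V R} (h : ∀ i j, Λ i j ≠ 0 → b i < b j) :
    (1 - Λ).det = 1 := by
  have ht : (1 - Λ).BlockTriangular b := by
    intro i j hij
    have hne : i ≠ j := by rintro rfl; exact lt_irrefl _ hij
    have : Λ i j = 0 := by
      by_contra h0
      exact absurd (h i j h0) (by omega)
    simp [Matrix.one_apply_ne hne, this]
  rw [ht.det]
  refine Finset.prod_eq_one fun k _ => ?_
  have : (1 - Λ).toSquareBlock b k = 1 := by
    ext ⟨i, hi⟩ ⟨j, hj⟩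
    have h0 : Λ i j = 0 := by
      by_contra h0
      have := h i j h0
      omega
    simp [Matrix.toSquareBlock_def, h0, Matrix.one_apply]
  rw [this, Matrix.det_one]

/-- The diagonal `0`-`1` matrix that projects onto the coordinates in `P`. -/
def mask (R : Type*) [CommRing R] (P : Finset V) : Matrix V V R :=
  Matrix.diagonal fun v => if v ∈ P then 1 else 0

/-- The `V × V` matrix whose `(u, v)` entry is the sum of the weights of the directed paths from `u`
to `v` inside `P`. For acyclic supports it is the inverse of `(I - Λ)_{P,P}`, extended by zero; the
adjugate is used in place of an inverse (the determinant is `1`) so that the definition is polynomial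
in the entries of `Λ` over any commutative ring. -/
def pathMatrix (P : Finset V) (Λ : Matrix V V R) : Matrix V V R :=
  mask R P * (1 - Λ * mask R P).adjugate

lemma mul_mask_apply (P : Finset V) (Λ : Matrix V V R) (u v : V) :
    (Λ * mask R P) u v = if v ∈ P then Λ u v else 0 := by
  simp [mask, Matrix.mul_diagonal]

lemma det_one_sub_mul_mask {b : V → ℕ} {Λ : Matrix V V R} (h : ∀ i j, Λ i j ≠ 0 → b i < b j)
    (P : Finset V) : (1 - Λ * mask R P).det = 1 := by
  refine det_one_sub_eq_one (b := b) fun i j hij => h i j ?_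
  rw [mul_mask_apply] at hij
  split_ifs at hij with hj
  · exact hij
  · exact absurd rfl hij

lemma pathMatrix_mul {b : V → ℕ} {Λ : Matrix V V R} (h : ∀ i j, Λ i j ≠ 0 → b i < b j)
    (P : Finset V) : pathMatrix P Λ * (1 - Λ * mask R P) = mask R P := by
  rw [pathMatrix, Matrix.mul_assoc, Matrix.adjugate_mul, det_one_sub_mul_mask h, one_smul,
    Matrix.mul_one]

/-- The last-edge recursion for path sums. -/
lemma pathMatrix_apply {b : V → ℕ} {Λ : Matrix V V R} (h : ∀ i j, Λ i j ≠ 0 → b i < b j)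
    (P : Finset V) (u v : V) : pathMatrix P Λ u v =
      if v ∈ P then (if u = v then 1 else 0) + ∑ w, pathMatrix P Λ u w * Λ w v else 0 := by
  have := congrFun (congrFun (pathMatrix_mul h P) u) v
  rw [mul_sub, mul_one, ← Matrix.mul_assoc, Matrix.sub_apply, mul_mask_apply, sub_eq_iff_eq_add] at this
  rw [this, Matrix.mul_apply, mask, Matrix.diagonal_apply]
  by_cases hv : v ∈ P
  · by_cases huv : u = v
    · subst huv; simp [hv]
    · simp [hv, huv]
  · by_cases huv : u = v
    · subst huv; simp [hv]
    · simp [hv, huv]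

lemma pathMatrix_apply_of_not_mem_left {P : Finset V} {u : V} (hu : u ∉ P) (Λ : Matrix V V R)
    (v : V) : pathMatrix P Λ u v = 0 := by
  simp [pathMatrix, mask, Matrix.diagonal_mul, hu]

lemma map_pathMatrix (φ : R →+* S) (P : Finset V) (Λ : Matrix V V R) :
    (pathMatrix P Λ).map φ = pathMatrix P (Λ.map φ) := by
  have hm : (mask R P).map φ = mask S P := by
    ext i j
    by_cases hij : i = j
    · subst hij; by_cases hi : i ∈ P <;> simp [mask, hi]
    · simp [mask, Matrix.diagonal_apply_ne _ hij]
  have h1 : φ.mapMatrix (1 - Λ * mask R P) = 1 - Λ.map φ * mask S P := by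
    rw [map_sub, map_one, map_mul, RingHom.mapMatrix_apply, RingHom.mapMatrix_apply, hm]
  rw [pathMatrix, pathMatrix, Matrix.map_mul, hm, ← h1, ← RingHom.map_adjugate,
    RingHom.mapMatrix_apply]

/-- The submatrix of `Σ^{(P,Q)}` written with the path matrices, which are indexed by all of `V`. -/
lemma restrictedSigmaSub_apply {b : V → ℕ} {Λ : Matrix V V ℝ} (h : ∀ i j, Λ i j ≠ 0 → b i < b j)
    {P Q A B : Finset V} (hA : A ⊆ P) (hB : B ⊆ Q) (Ω : Matrix V V ℝ) (x : A) (y : B) :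
    restrictedSigmaSub hA hB Λ Ω x y =
      ((pathMatrix P Λ).transpose * Ω * pathMatrix Q Λ) x y := by
  have inv : ∀ P : Finset V,
      ((1 - Λ).submatrix (fun i : P => (i : V)) (fun j : P => (j : V)))⁻¹ =
        (pathMatrix P Λ).submatrix (fun i : P => (i : V)) (fun j : P => (j : V)) := by
    intro P
    refine Matrix.inv_eq_left_inv ?_
    ext u v
    have hsum : ∑ w : P, pathMatrix P Λ u w * Λ w v = ∑ w, pathMatrix P Λ u w * Λ w v := by
      rw [Finset.sum_coe_sort P (fun w => pathMatrix P Λ u w * Λ w v)]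
      refine Finset.sum_subset (Finset.subset_univ _) fun w _ hw => ?_
      rw [pathMatrix_apply h P u w, if_neg hw, zero_mul]
    have hone : ∑ w : P, pathMatrix P Λ u w * (1 : Matrix V V ℝ) w v = pathMatrix P Λ u v := by
      rw [Finset.sum_eq_single v]
      · simp
      · intro w _ hw
        rw [Matrix.one_apply_ne (fun h => hw (Subtype.ext h)), mul_zero]
      · simp
    simp only [Matrix.mul_apply, Matrix.submatrix_apply, Matrix.sub_apply, mul_sub,
      Finset.sum_sub_distrib, hsum, hone]
    rw [pathMatrix_apply h P u v, if_pos v.2]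
    simp [Matrix.one_apply]
  rw [restrictedSigmaSub, restrictedSigma, inv P, inv Q]
  simp only [Matrix.submatrix_apply, Matrix.mul_apply, Matrix.transpose_apply]
  rw [Finset.sum_coe_sort Q (fun v => (∑ u : P, pathMatrix P Λ u x * Ω u v) * pathMatrix Q Λ v y)]
  refine (Finset.sum_subset (Finset.subset_univ _) fun v _ hv => ?_).trans
    (Finset.sum_congr rfl fun v _ => ?_)
  · rw [pathMatrix_apply_of_not_mem_left hv, mul_zero]
  · rw [Finset.sum_coe_sort P (fun u => pathMatrix P Λ u x * Ω u v)]
    congr 1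
    refine Finset.sum_subset (Finset.subset_univ _) fun u _ hu => ?_
    rw [pathMatrix_apply_of_not_mem_left hu, zero_mul]

/-- Forbidding the vertices of `S` changes the path matrix by a matrix of rank at most `|S|`, because
every path that is lost passes through `S`. -/
lemma rank_pathMatrix_sub_le {b : V → ℕ} {Λ : Matrix V V ℝ} (h : ∀ i j, Λ i j ≠ 0 → b i < b j)
    (P S : Finset V) : (pathMatrix P Λ - pathMatrix (P \ S) Λ).rank ≤ S.card := by
  set N := 1 - Λ * mask ℝ P
  set D := pathMatrix P Λ - pathMatrix (P \ S) Λ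
  have hN : IsUnit N.det := by rw [det_one_sub_mul_mask h]; exact isUnit_one
  -- `D * N` vanishes outside the columns in `S`.
  have hDN : D * N = D * N * mask ℝ S := by
    ext u v
    rw [mul_mask_apply]
    split_ifs with hv
    · rfl
    · have e : (D * N) u v = D u v - if v ∈ P then ∑ w, D u w * Λ w v else 0 := by
        rw [mul_sub, mul_one, ← Matrix.mul_assoc, Matrix.sub_apply, mul_mask_apply,
          Matrix.mul_apply]
      rw [e]
      simp only [D, Matrix.sub_apply, sub_mul, Finset.sum_sub_distrib]
      rw [pathMatrix_apply h P u v, pathMatrix_apply h (P \ S) u v]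
      by_cases hP : v ∈ P <;> simp [hP, hv]
  rw [← Matrix.rank_mul_eq_left_of_isUnit_det N D hN, hDN]
  refine (Matrix.rank_mul_le_right _ _).trans ?_
  rw [mask, Matrix.rank_diagonal, Fintype.card_subtype]
  refine Finset.card_le_card fun v hv => ?_
  by_contra hv'
  simp [hv'] at hv

end PathMatrices

/-! ### Sums over vertex-disjoint path families -/

section PathFamilies

variable {V : Type*} (G : MixedGraph V) {ι : Type*}

/-- The product of the entries of `Λ` along consecutive entries of a list of vertices. -/
def listWeight (Λ : Matrix V V ℝ) (l : List V) : ℝ :=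
  (List.zipWith (fun i j => Λ i j) l l.tail).prod

lemma listWeight_concat (Λ : Matrix V V ℝ) (l : List V) (s : V) :
    listWeight Λ (l ++ [s]) = l.getLast?.elim 1 (fun w => Λ w s) * listWeight Λ l := by
  induction l with
  | nil => simp [listWeight]
  | cons x l ih =>
    cases l with
    | nil => simp [listWeight]
    | cons y l =>
      simp only [listWeight, List.cons_append, List.tail_cons, List.zipWith_cons_cons,
        List.prod_cons, List.getLast?_cons_cons] at ih ⊢
      rw [ih]
      ring

lemma pairwise_lt_of_isChain {b : V → ℕ} (hb : ∀ i j, G.dir i j → b i < b j) {l : List V}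
    (hl : l.IsChain G.dir) : l.Pairwise fun u v => b u < b v := by
  have : Trans (fun u v => b u < b v) (fun u v => b u < b v) (fun u v => b u < b v) :=
    ⟨fun h h' => lt_trans h h'⟩
  exact (hl.imp hb).pairwise

/-- The families of pairwise vertex-disjoint directed paths inside `P` where the `i`-th path ends at
`a i`. A path is the list of its vertices; the `i`-th list is empty when `a i = none`. -/
def disjointFamilies (P : Finset V) (a : ι → Option V) : Set (ι → List V) :=
  {p | (∀ i, (p i).IsChain G.dir ∧ (p i).getLast? = a i ∧ ∀ v ∈ p i, v ∈ P) ∧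
    ∀ i j, i ≠ j → (p i).Disjoint (p j)}

variable {G}

lemma finite_disjointFamilies [Finite V] [Finite ι] {b : V → ℕ}
    (hb : ∀ i j, G.dir i j → b i < b j) (P : Finset V) (a : ι → Option V) :
    (G.disjointFamilies P a).Finite := by
  classical
  cases nonempty_fintype V
  have hfin : {l : List V | l.Nodup}.Finite :=
    Set.finite_coe_iff.1 (inferInstanceAs (Finite {l : List V // l.Nodup}))
  refine (Set.Finite.pi' (t := fun _ : ι => {l : List V | l.Nodup}) fun _ => hfin).subset ?_
  intro p hp i
  exact (G.pairwise_lt_of_isChain hb (hp.1 i).1).imp fun h => by rintro rfl; exact lt_irrefl _ h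

/-- Deleting the common last vertex `s` of the `i`-th paths identifies the families whose `i`-th path
reaches `s` from `x` (or is `[s]`, if `x = none`) with the families in `P \ {s}` whose `i`-th path ends
at `x`. -/
lemma disjointFamilies_inter_eq_image [DecidableEq V] [DecidableEq ι] {b : V → ℕ}
    (hb : ∀ i j, G.dir i j → b i < b j) {P : Finset V} {a : ι → Option V} {s : V} (hs : s ∈ P)
    {i : ι} (hi : a i = some s) {x : Option V} (hx : ∀ w ∈ x, G.dir w s) :
    {p | p ∈ G.disjointFamilies P a ∧ (p i).dropLast.getLast? = x} =
      (fun p => Function.update p i (p i ++ [s])) ''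
        G.disjointFamilies (P.erase s) (Function.update a i x) := by
  ext p
  constructor
  · rintro ⟨⟨hp, hd⟩, hpx⟩
    have hlast := (hp i).2.1
    rw [hi] at hlast
    obtain ⟨q, hq⟩ : ∃ q, p i = q ++ [s] := List.getLast?_eq_some_iff.1 hlast
    have hqx : q.getLast? = x := by rw [← hpx, hq, List.dropLast_concat]
    have hsq : s ∉ q := by
      intro hmem
      have := G.pairwise_lt_of_isChain hb (hp i).1
      rw [hq, List.pairwise_append] at this
      exact lt_irrefl _ (this.2.2 s hmem s (by simp))
    have hsub : ∀ j, ∀ v ∈ Function.update p i q j, v ∈ p j := by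
      intro j v hv
      rcases eq_or_ne j i with rfl | hj
      · rw [Function.update_self] at hv
        rw [hq]; exact List.mem_append_left _ hv
      · rwa [Function.update_of_ne hj] at hv
    refine ⟨Function.update p i q, ⟨fun j => ?_, fun j k hjk v hv hv' =>
      hd j k hjk (hsub j v hv) (hsub k v hv')⟩, ?_⟩
    · refine ⟨?_, ?_, fun v hv => Finset.mem_erase.2 ⟨?_, (hp j).2.2 v (hsub j v hv)⟩⟩
      · rcases eq_or_ne j i with rfl | hj
        · rw [Function.update_self]
          have := (hp j).1
          rw [hq, List.isChain_append] at this
          exact this.1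
        · rw [Function.update_of_ne hj]; exact (hp j).1
      · rcases eq_or_ne j i with rfl | hj
        · rw [Function.update_self, Function.update_self, hqx]
        · rw [Function.update_of_ne hj, Function.update_of_ne hj]; exact (hp j).2.1
      · rintro rfl
        rcases eq_or_ne j i with rfl | hj
        · rw [Function.update_self] at hv; exact hsq hv
        · exact hd j i hj (hsub j _ hv) (by rw [hq]; simp)
    · simp only [Function.update_self, Function.update_idem, ← hq, Function.update_eq_self]
  · rintro ⟨p, ⟨hp, hd⟩, rfl⟩
    have hlast := (hp i).2.1
    rw [Function.update_self] at hlast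
    refine ⟨⟨fun j => ?_, fun j k hjk => ?_⟩, ?_⟩ <;> dsimp only
    · rcases eq_or_ne j i with rfl | hj
      · rw [Function.update_self]
        refine ⟨List.isChain_append.2 ⟨(hp j).1, by simp, ?_⟩, by simp [hi], ?_⟩
        · intro w hw v hv
          rw [hlast] at hw
          simp only [List.head?_cons, Option.mem_def, Option.some.injEq] at hv
          exact hv ▸ hx w hw
        · intro v hv
          rcases List.mem_append.1 hv with hv | hv
          · exact Finset.mem_of_mem_erase ((hp j).2.2 v hv)
          · rw [List.mem_singleton.1 hv]; exact hs
      · rw [Function.update_of_ne hj]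
        refine ⟨(hp j).1, ?_, fun v hv => Finset.mem_of_mem_erase ((hp j).2.2 v hv)⟩
        rw [(hp j).2.1, Function.update_of_ne hj]
    · have key : ∀ k, k ≠ i → (p i ++ [s]).Disjoint (p k) := by
        intro k hk v hv hv'
        rcases List.mem_append.1 hv with hv | hv
        · exact hd i k hk.symm hv hv'
        · rw [List.mem_singleton.1 hv] at hv'
          exact Finset.ne_of_mem_erase ((hp k).2.2 s hv') rfl
      rcases eq_or_ne j i with rfl | hj
      · rw [Function.update_self, Function.update_of_ne hjk.symm]
        exact key k hjk.symm
      · rcases eq_or_ne k i with rfl | hk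
        · rw [Function.update_self, Function.update_of_ne hj]
          exact (key j hj).symm
        · rw [Function.update_of_ne hj, Function.update_of_ne hk]
          exact hd j k hjk
    · simp [hlast]

/-- A one-sided Lindström–Gessel–Viennot lemma. The vectors `Y v` are the weighted sums, over the
directed paths in `P` that end at `v`, of the vectors `C u` at the first vertices `u` of the paths. An
alternating form evaluated at some of the `Y v` is then a sum over vertex-disjoint path families only.
The slots `i` with `a i = none` hold arbitrary vectors `D i`; they make the induction work, in which a
sink of `P` is deleted and a path that consists of the sink alone is finished. -/
theorem alternating_eq_sum_disjointFamilies [Fintype V] [DecidableEq V] [Fintype ι] [DecidableEq ι]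
    {E : Type*} [AddCommGroup E] [Module ℝ E] (f : E [⋀^ι]→ₗ[ℝ] ℝ) {b : V → ℕ}
    (hb : ∀ i j, G.dir i j → b i < b j) {Λ : Matrix V V ℝ} (hΛ : Λ ∈ G.lambdaSpace) (C : V → E)
    (P : Finset V) (D : ι → E) (Y : V → E)
    (hY : ∀ v, Y v = if v ∈ P then C v + ∑ w, Λ w v • Y w else 0) (a : ι → Option V) :
    f (fun i => (a i).elim (D i) Y) = ∑ᶠ p ∈ G.disjointFamilies P a,
      (∏ i, listWeight Λ (p i)) * f (fun i => (p i).head?.elim (D i) C) := by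
  induction hn : P.card generalizing P D Y a with
  | zero =>
    obtain rfl := Finset.card_eq_zero.1 hn
    have hY0 : Y = 0 := by ext v; simpa using hY v
    by_cases ha : ∀ i, a i = none
    · have : G.disjointFamilies ∅ a = {fun _ => []} := by
        ext p
        constructor
        · intro hp
          ext1 i
          have := (hp.1 i).2.1
          rwa [ha, List.getLast?_eq_none_iff] at this
        · rintro rfl
          exact ⟨fun i => ⟨List.IsChain.nil, by simp [ha], by simp⟩, fun i j _ => by simp⟩
      rw [this, finsum_mem_singleton]
      simp [ha, listWeight]
    · push Not at ha
      obtain ⟨i, hi⟩ := ha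
      obtain ⟨s, hs⟩ := Option.ne_none_iff_exists'.1 hi
      have : G.disjointFamilies ∅ a = ∅ := by
        refine Set.eq_empty_of_forall_notMem fun p hp => ?_
        have h1 := (hp.1 i).2.1
        rw [hs] at h1
        simpa using (hp.1 i).2.2 s (List.mem_of_getLast? h1)
      rw [this, finsum_mem_empty]
      exact f.map_coord_zero i (by simp [hs, hY0])
  | succ n ih =>
    have hne : P.Nonempty := Finset.card_pos.1 (by omega)
    obtain ⟨s, hs, hmax⟩ := P.exists_max_image b hne
    have hcard : (P.erase s).card = n := by rw [Finset.card_erase_of_mem hs, hn]; rfl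
    have hsink : ∀ v ∈ P, Λ s v = 0 := fun v hv =>
      hΛ s v fun h => absurd (hb _ _ h) (not_lt.2 (hmax v hv))
    set Y' : V → E := fun v => if v = s then 0 else Y v with hY'
    have hYY' : ∀ v ∈ P, ∑ w, Λ w v • Y w = ∑ w, Λ w v • Y' w := by
      intro v hv
      refine Finset.sum_congr rfl fun w _ => ?_
      by_cases hw : w = s
      · rw [hw, hsink v hv, zero_smul, zero_smul]
      · simp [hY', hw]
    have hYrec : ∀ v, Y' v = if v ∈ P.erase s then C v + ∑ w, Λ w v • Y' w else 0 := by
      intro v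
      by_cases hv : v = s
      · simp [hY', hv]
      · by_cases hvP : v ∈ P
        · rw [if_pos (Finset.mem_erase.2 ⟨hv, hvP⟩), ← hYY' v hvP]
          simp only [hY', if_neg hv]
          rw [hY v, if_pos hvP]
        · rw [if_neg (fun h => hvP (Finset.mem_of_mem_erase h))]
          simp only [hY', if_neg hv]
          rw [hY v, if_neg hvP]
    by_cases hex : ∃ i, a i = some s
    swap
    · push Not at hex
      have hfam : G.disjointFamilies P a = G.disjointFamilies (P.erase s) a := by
        ext p
        refine and_congr_left fun _ => forall_congr' fun i => and_congr_right fun hc =>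
          and_congr_right fun hl => ⟨fun h v hv => ?_, fun h v hv =>
            Finset.mem_of_mem_erase (h v hv)⟩
        refine Finset.mem_erase.2 ⟨?_, h v hv⟩
        rintro rfl
        obtain ⟨q, t, hq⟩ := List.eq_nil_or_concat' (p i) |>.resolve_left (List.ne_nil_of_mem hv)
        have hbp := G.pairwise_lt_of_isChain hb hc
        rw [hq, List.pairwise_append] at hbp
        rw [hq, List.mem_append, List.mem_singleton] at hv
        rcases hv with hv | rfl
        · exact absurd (hbp.2.2 _ hv t (by simp)) (not_lt.2 (hmax t (h t (by rw [hq]; simp))))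
        · rw [hq] at hl
          exact hex i (by simpa using hl.symm)
      rw [hfam, ← ih (P.erase s) D Y' hYrec a hcard]
      congr 1
      ext1 i
      rcases h : a i with _ | v
      · rfl
      · have : v ≠ s := by rintro rfl; exact hex i h
        simp [hY', this]
    obtain ⟨i, hi⟩ := hex
    by_cases hex2 : ∃ j, j ≠ i ∧ a j = some s
    · obtain ⟨j, hji, hj⟩ := hex2
      have : G.disjointFamilies P a = ∅ := by
        refine Set.eq_empty_of_forall_notMem fun p hp => ?_
        exact hp.2 j i hji (List.mem_of_getLast? ((hp.1 j).2.1.trans hj))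
          (List.mem_of_getLast? ((hp.1 i).2.1.trans hi))
      rw [this, finsum_mem_empty]
      exact f.map_eq_zero_of_eq _ (by simp [hi, hj]) hji
    push Not at hex2
    -- `c x` is the weight of the last edge of a path that reaches `s` from `x`.
    set c : Option V → ℝ := fun x => x.elim 1 fun w => Λ w s with hc
    set D' : ι → E := Function.update D i (C s) with hD'
    have hYs : Y s = ∑ x : Option V, c x • x.elim (C s) Y' := by
      rw [Fintype.sum_option, hY s, if_pos hs, hYY' s hs]
      simp [hc]
    have hrow : (fun j => (a j).elim (D j) Y) =
        Function.update (fun j => (a j).elim (D' j) Y') i (Y s) := by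
      ext1 j
      rcases eq_or_ne j i with rfl | hj
      · simp [hi]
      · rw [Function.update_of_ne hj]
        rcases h : a j with _ | v
        · simp [hD', Function.update_of_ne hj]
        · have : v ≠ s := by rintro rfl; exact hex2 j hj h
          simp [hY', this]
    have hrow' : ∀ x : Option V,
        Function.update (fun j => (a j).elim (D' j) Y') i (x.elim (C s) Y') =
          fun j => (Function.update a i x j).elim (D' j) Y' := by
      intro x
      ext1 j
      rcases eq_or_ne j i with rfl | hj
      · simp [hD']
      · simp [Function.update_of_ne hj]
    have hunion : G.disjointFamilies P a =
        ⋃ x, {p | p ∈ G.disjointFamilies P a ∧ (p i).dropLast.getLast? = x} := by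
      ext p; simp
    rw [hrow, hYs, f.map_update_sum, hunion, finsum_mem_iUnion, finsum_eq_sum_of_fintype]
    · refine Finset.sum_congr rfl fun x _ => ?_
      rw [f.map_update_smul, hrow', smul_eq_mul]
      by_cases hx : ∀ w ∈ x, G.dir w s
      · rw [disjointFamilies_inter_eq_image hb hs hi hx, finsum_mem_image,
          ih (P.erase s) D' Y' hYrec _ hcard, mul_finsum_mem]
        · refine finsum_mem_congr rfl fun p hp => ?_
          rw [← mul_assoc]
          congr 1
          · have hlast := (hp.1 i).2.1
            rw [Function.update_self] at hlast
            rw [← Finset.mul_prod_erase _ _ (Finset.mem_univ i),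
              ← Finset.mul_prod_erase _ (fun j => listWeight Λ (Function.update p i (p i ++ [s]) j))
              (Finset.mem_univ i), Function.update_self, listWeight_concat, hlast, ← mul_assoc]
            congr 1
            refine Finset.prod_congr rfl fun j hj => ?_
            rw [Function.update_of_ne (Finset.ne_of_mem_erase hj)]
          · congr 1
            ext1 j
            rcases eq_or_ne j i with rfl | hj
            · rw [Function.update_self, hD', Function.update_self]
              cases p j <;> simp
            · rw [Function.update_of_ne hj, hD', Function.update_of_ne hj]
        · intro p _ q _ hpq
          ext1 j
          have := congrFun hpq j
          rcases eq_or_ne j i with rfl | hj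
          · simpa using this
          · simpa [Function.update_of_ne hj] using this
      · push Not at hx
        obtain ⟨w, rfl, hws⟩ := hx
        have : {p | p ∈ G.disjointFamilies P a ∧ (p i).dropLast.getLast? = some w} = ∅ := by
          refine Set.eq_empty_of_forall_notMem fun p hp => hws ?_
          obtain ⟨q, hq⟩ : ∃ q, p i = q ++ [s] :=
            List.getLast?_eq_some_iff.1 ((hp.1.1 i).2.1.trans hi)
          have h1 := (hp.1.1 i).1
          have h2 := hp.2
          rw [hq, List.dropLast_concat] at h2
          rw [hq, List.isChain_append] at h1
          exact h1.2.2 w h2 s (by simp)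
        rw [this, finsum_mem_empty]
        simp [hc, hΛ w s hws]
    · exact fun x y hxy => Set.disjoint_left.2 fun p hp hp' => hxy (hp.2.symm.trans hp'.2)
    · exact fun x => (finite_disjointFamilies hb P a).subset fun p hp => hp.1

end PathFamilies

/-! ### Determinants as sums over trek systems -/

section TrekSystems

variable {V : Type*} {G : MixedGraph V} {P Q A B : Finset V} {n : ℕ}

lemma DirPath.ext_verts {p q : G.DirPath} (h : p.verts = q.verts) : p = q := by
  cases p; cases q; cases h; rfl

lemma Trek.ext_verts {τ τ' : G.Trek} (hl : τ.left.verts = τ'.left.verts)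
    (hr : τ.right.verts = τ'.right.verts) : τ = τ' := by
  cases τ; cases τ'
  cases DirPath.ext_verts hl
  cases DirPath.ext_verts hr
  rfl

lemma TrekSystem.ext_trek {T T' : G.TrekSystem A B} (he : T.toEquiv = T'.toEquiv)
    (ht : T.trek = T'.trek) : T = T' := by
  cases T; cases T'; cases he; cases ht; rfl

lemma DirPath.getLast?_verts (p : G.DirPath) : p.verts.getLast? = some p.last :=
  List.getLast?_eq_some_getLast p.ne_nil

lemma DirPath.head?_verts (p : G.DirPath) : p.verts.head? = some p.first :=
  List.head?_eq_some_head p.ne_nil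

/-- The data that determine a trek system, for orderings `α` of `A` and `β` of `B`: its permutation,
the left sides indexed by their ends in `A`, and the right sides indexed by their ends in `B`. -/
def TrekSystem.code (α : Fin n ≃ A) (β : Fin n ≃ B) (T : G.TrekSystem A B) :
    Equiv.Perm (Fin n) × (Fin n → List V) × (Fin n → List V) :=
  ((α.trans T.toEquiv).trans β.symm, fun i => (T.trek (α i)).left.verts,
    fun j => (T.trek (T.toEquiv.symm (β j))).right.verts)

lemma TrekSystem.code_injective (α : Fin n ≃ A) (β : Fin n ≃ B) :
    Function.Injective (TrekSystem.code (G := G) α β) := by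
  intro T T' h
  simp only [TrekSystem.code, Prod.mk.injEq] at h
  obtain ⟨h1, h2, h3⟩ := h
  have he : T.toEquiv = T'.toEquiv := by
    ext a
    have := Equiv.congr_fun h1 (α.symm a)
    simpa using this
  refine TrekSystem.ext_trek he (funext fun a => Trek.ext_verts ?_ ?_)
  · simpa using congrFun h2 (α.symm a)
  · have := congrFun h3 (β.symm (T.toEquiv a))
    simp only [Equiv.apply_symm_apply, Equiv.symm_apply_apply] at this
    rw [this, he, Equiv.symm_apply_apply]

/-- The possible codes of trek systems, before the tops of the treks are taken into account. -/
def codeSet (G : MixedGraph V) (P Q : Finset V) (α : Fin n ≃ A) (β : Fin n ≃ B) :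
    Set (Equiv.Perm (Fin n) × (Fin n → List V) × (Fin n → List V)) :=
  Set.univ ×ˢ (G.disjointFamilies P (fun i => some (α i : V)) ×ˢ
    G.disjointFamilies Q (fun j => some (β j : V)))

lemma TrekSystem.code_mem_codeSet (α : Fin n ≃ A) (β : Fin n ≃ B) {T : G.TrekSystem A B}
    (hT : T ∈ G.restrictedSystems P Q A B) : T.code α β ∈ codeSet G P Q α β := by
  refine ⟨Set.mem_univ _, ⟨fun i => ⟨(T.trek _).left.chain, ?_, (hT.1 _).1⟩, fun i j hij => ?_⟩,
    ⟨fun j => ⟨(T.trek _).right.chain, ?_, (hT.1 _).2⟩, fun i j hij => ?_⟩⟩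
  · rw [TrekSystem.code, DirPath.getLast?_verts]
    exact congrArg some (T.source_eq _)
  · exact Set.disjoint_left.1 (hT.2 _ _ (α.injective.ne hij)).1
  · rw [TrekSystem.code, DirPath.getLast?_verts]
    refine congrArg some ((T.target_eq _).trans ?_)
    rw [Equiv.apply_symm_apply]
  · exact Set.disjoint_left.1 (hT.2 _ _ (T.toEquiv.symm.injective.ne (β.injective.ne hij))).2

lemma exists_trekSystem_code_eq {α : Fin n ≃ A} {β : Fin n ≃ B}
    {x : Equiv.Perm (Fin n) × (Fin n → List V) × (Fin n → List V)} (hx : x ∈ codeSet G P Q α β)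
    (htop : ∀ i, ∀ u ∈ (x.2.1 i).head?, ∀ v ∈ (x.2.2 (x.1 i)).head?, u = v ∨ G.bidir.Adj u v) :
    ∃ T ∈ G.restrictedSystems P Q A B, TrekSystem.code α β T = x := by
  obtain ⟨σ, p, q⟩ := x
  obtain ⟨-, ⟨hp, hpd⟩, hq, hqd⟩ := hx
  have hp0 : ∀ i, p i ≠ [] := fun i h => by simpa [h] using (hp i).2.1
  have hq0 : ∀ i, q i ≠ [] := fun i h => by simpa [h] using (hq i).2.1
  let T : G.TrekSystem A B :=
    { toEquiv := (α.symm.trans σ).trans β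
      trek := fun a =>
        { left := ⟨p (α.symm a), hp0 _, (hp _).1⟩
          right := ⟨q (σ (α.symm a)), hq0 _, (hq _).1⟩
          top := htop _ _ (List.head?_eq_some_head (hp0 _)) _ (List.head?_eq_some_head (hq0 _)) }
      source_eq := fun a => by
        have := (hp (α.symm a)).2.1
        rw [List.getLast?_eq_some_getLast (hp0 _)] at this
        exact (Option.some.inj this).trans (congrArg Subtype.val (α.apply_symm_apply a))
      target_eq := fun a => by
        have := (hq (σ (α.symm a))).2.1
        rw [List.getLast?_eq_some_getLast (hq0 _)] at this
        exact Option.some.inj this }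
  refine ⟨T, ⟨fun a => ⟨(hp _).2.2, (hq _).2.2⟩, fun a b hab => ⟨?_, ?_⟩⟩, ?_⟩
  · exact Set.disjoint_left.2 (hpd _ _ (α.symm.injective.ne hab))
  · exact Set.disjoint_left.2 (hqd _ _ (σ.injective.ne (α.symm.injective.ne hab)))
  · have hσ : (α.trans T.toEquiv).trans β.symm = σ := by ext i; simp [T]
    rw [TrekSystem.code, hσ]
    simp [T]

/-- The signed contribution of a code to the determinant. -/
def codeWeight (Λ Ω : Matrix V V ℝ)
    (x : Equiv.Perm (Fin n) × (Fin n → List V) × (Fin n → List V)) : ℝ :=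
  ((Equiv.Perm.sign x.1 : ℤ) : ℝ) * ((∏ i, listWeight Λ (x.2.1 i)) * ((∏ j, listWeight Λ (x.2.2 j)) *
    ∏ i, (x.2.1 i).head?.elim 0 fun u => (x.2.2 (x.1 i)).head?.elim 0 fun v => Ω u v))

lemma TrekSystem.codeWeight_code (α : Fin n ≃ A) (β : Fin n ≃ B) (Λ Ω : Matrix V V ℝ)
    (T : G.TrekSystem A B) :
    codeWeight Λ Ω (T.code α β) = ((T.sign α β : ℤ) : ℝ) * T.monomial Λ Ω := by
  have h : ∏ j, listWeight Λ ((T.code α β).2.2 j) =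
      ∏ i, listWeight Λ ((T.trek (α i)).right.verts) := by
    rw [← Equiv.prod_comp ((α.trans T.toEquiv).trans β.symm)]
    simp [TrekSystem.code]
  rw [codeWeight, h, TrekSystem.monomial, ← Equiv.prod_comp α, ← Finset.prod_mul_distrib,
    ← Finset.prod_mul_distrib]
  congr 1
  refine Finset.prod_congr rfl fun i _ => ?_
  simp only [TrekSystem.code, Equiv.trans_apply, Equiv.apply_symm_apply, Equiv.symm_apply_apply,
    DirPath.head?_verts, Option.elim_some]
  rw [Trek.monomial]
  simp only [DirPath.weight, listWeight]
  ring

variable [Fintype V]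

lemma finite_codeSet {b : V → ℕ} (hb : ∀ i j, G.dir i j → b i < b j) (α : Fin n ≃ A)
    (β : Fin n ≃ B) : (codeSet G P Q α β).Finite :=
  Set.finite_univ.prod ((finite_disjointFamilies hb _ _).prod (finite_disjointFamilies hb _ _))

lemma finite_restrictedSystems {b : V → ℕ} (hb : ∀ i j, G.dir i j → b i < b j) (α : Fin n ≃ A)
    (β : Fin n ≃ B) : (G.restrictedSystems P Q A B).Finite :=
  Set.Finite.of_finite_image ((finite_codeSet (P := P) (Q := Q) hb α β).subset
    (Set.image_subset_iff.2 fun _ hT => TrekSystem.code_mem_codeSet α β hT))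
    (TrekSystem.code_injective α β).injOn

variable [DecidableEq V]

lemma sum_pathMatrix_smul {E : Type*} [AddCommGroup E] [Module ℝ E] {b : V → ℕ} {Λ : Matrix V V ℝ}
    (h : ∀ i j, Λ i j ≠ 0 → b i < b j) (P : Finset V) (C : V → E) (v : V) :
    ∑ u, pathMatrix P Λ u v • C u =
      if v ∈ P then C v + ∑ w, Λ w v • ∑ u, pathMatrix P Λ u w • C u else 0 := by
  split_ifs with hv
  · simp_rw [Finset.smul_sum]
    rw [Finset.sum_comm]
    have : C v = ∑ u, (if u = v then (1 : ℝ) else 0) • C u := by simp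
    rw [this, ← Finset.sum_add_distrib]
    refine Finset.sum_congr rfl fun u _ => ?_
    rw [pathMatrix_apply h P u v, if_pos hv, add_smul, Finset.sum_smul]
    simp_rw [smul_smul, mul_comm (Λ _ v)]
  · refine Finset.sum_eq_zero fun u _ => ?_
    rw [pathMatrix_apply h P u v, if_neg hv, zero_smul]

/-- The determinant as a sum over the trek systems with no sided intersection: the one-sided path
formula is applied to the rows for the left sides, then to the columns for the right sides, and the
remaining determinant of entries of `Ω` is expanded over the permutations. -/
lemma det_eq_finsum_codeWeight {b : V → ℕ} (hb : ∀ i j, G.dir i j → b i < b j) {Λ : Matrix V V ℝ}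
    (hΛ : Λ ∈ G.lambdaSpace) (Ω : Matrix V V ℝ) (α : Fin n ≃ A) (β : Fin n ≃ B) :
    (Matrix.of fun i j => ((pathMatrix P Λ).transpose * Ω * pathMatrix Q Λ) (α i) (β j)).det =
      ∑ᶠ x ∈ codeSet G P Q α β, codeWeight Λ Ω x := by
  have h : ∀ i j, Λ i j ≠ 0 → b i < b j := lt_of_ne_zero hb hΛ
  have hP := finite_disjointFamilies hb P (fun i => some (α i : V))
  have hQ := finite_disjointFamilies hb Q (fun j => some (β j : V))
  set C : V → Fin n → ℝ := fun u j => ∑ v, Ω u v * pathMatrix Q Λ v (β j) with hC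
  have e1 : (Matrix.of fun i j =>
        ((pathMatrix P Λ).transpose * Ω * pathMatrix Q Λ) (α i) (β j)).det =
      Matrix.detRowAlternating
        (fun i => (some (α i : V)).elim 0 fun v => ∑ u, pathMatrix P Λ u v • C u) := by
    congr 1
    ext i j
    simp only [Matrix.of_apply, Option.elim_some, Finset.sum_apply, Pi.smul_apply, smul_eq_mul, hC]
    rw [Matrix.mul_assoc, Matrix.mul_apply]
    simp only [Matrix.transpose_apply, Matrix.mul_apply]
  have e2 : ∀ p : Fin n → List V,
      Matrix.detRowAlternating (fun i => (p i).head?.elim 0 C) =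
        ∑ᶠ q ∈ G.disjointFamilies Q (fun j => some (β j : V)), (∏ j, listWeight Λ (q j)) *
          ∑ σ : Equiv.Perm (Fin n), ((Equiv.Perm.sign σ : ℤ) : ℝ) *
            ∏ i, (p i).head?.elim 0 fun u => (q (σ i)).head?.elim 0 fun v => Ω u v := by
    intro p
    set C' : V → Fin n → ℝ := fun v i => (p i).head?.elim 0 fun u => Ω u v with hC'
    have e3 : Matrix.detRowAlternating (fun i => (p i).head?.elim 0 C) =
        Matrix.detRowAlternating
          (fun j => (some (β j : V)).elim 0 fun v => ∑ u, pathMatrix Q Λ u v • C' u) := by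
      refine (Matrix.det_transpose _).symm.trans ?_
      congr 1
      ext j i
      change (p i).head?.elim 0 C j = _
      simp only [Option.elim_some, Finset.sum_apply, Pi.smul_apply, smul_eq_mul, hC']
      cases (p i).head? with
      | none => simp
      | some u => simp only [Option.elim_some, hC, mul_comm]
    rw [e3]
    refine (alternating_eq_sum_disjointFamilies _ hb hΛ C' Q (fun _ => 0) _
      (sum_pathMatrix_smul h Q C') _).trans ?_
    refine finsum_mem_congr rfl fun q _ => ?_
    congr 1
    refine (Matrix.det_apply' _).trans (Finset.sum_congr rfl fun σ _ => ?_)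
    congr 1
    refine Finset.prod_congr rfl fun i _ => ?_
    cases (q (σ i)).head? <;> cases hpi : (p i).head? <;> simp [hC', hpi]
  rw [e1]
  refine (alternating_eq_sum_disjointFamilies _ hb hΛ C P (fun _ => 0) _
    (sum_pathMatrix_smul h P C) _).trans ?_
  simp_rw [e2]
  rw [finsum_mem_eq_finite_toFinset_sum _ hP, finsum_mem_eq_finite_toFinset_sum _
    (finite_codeSet hb α β)]
  have hset : (finite_codeSet (P := P) (Q := Q) hb α β).toFinset =
      Finset.univ ×ˢ (hP.toFinset ×ˢ hQ.toFinset) := by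
    ext x; simp [codeSet]
  rw [hset, Finset.sum_product, Finset.sum_comm, Finset.sum_product]
  refine Finset.sum_congr rfl fun p _ => ?_
  rw [finsum_mem_eq_finite_toFinset_sum _ hQ, Finset.mul_sum]
  refine Finset.sum_congr rfl fun q _ => ?_
  rw [Finset.mul_sum, Finset.mul_sum]
  refine Finset.sum_congr rfl fun σ _ => ?_
  simp only [codeWeight]
  ring

theorem det_restrictedSigmaSub {b : V → ℕ} (hb : ∀ i j, G.dir i j → b i < b j) {Λ Ω : Matrix V V ℝ}
    (hΛ : Λ ∈ G.lambdaSpace) (hΩ : Ω ∈ G.omegaSpace) (hA : A ⊆ P) (hB : B ⊆ Q) (α : Fin n ≃ A)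
    (β : Fin n ≃ B) :
    ((restrictedSigmaSub hA hB Λ Ω).submatrix α β).det =
      ∑ᶠ T ∈ G.restrictedSystems P Q A B, ((T.sign α β : ℤ) : ℝ) * T.monomial Λ Ω := by
  have h : ∀ i j, Λ i j ≠ 0 → b i < b j := lt_of_ne_zero hb hΛ
  have e : (restrictedSigmaSub hA hB Λ Ω).submatrix α β =
      Matrix.of fun i j => ((pathMatrix P Λ).transpose * Ω * pathMatrix Q Λ) (α i) (β j) := by
    ext i j
    rw [Matrix.submatrix_apply, restrictedSigmaSub_apply h]
    rfl
  rw [e, det_eq_finsum_codeWeight hb hΛ]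
  simp_rw [← TrekSystem.codeWeight_code α β]
  rw [← finsum_mem_image (TrekSystem.code_injective α β).injOn]
  refine finsum_mem_inter_support_eq _ _ _ (Set.ext fun x => and_congr_left fun hx => ?_)
  refine ⟨fun hxc => ?_, ?_⟩
  · refine exists_trekSystem_code_eq hxc fun i u hu v hv => ?_
    by_contra! hno
    refine hx ?_
    have : ∏ i, ((x.2.1 i).head?.elim 0 fun u => (x.2.2 (x.1 i)).head?.elim 0 fun v => Ω u v) = 0 := by
      refine Finset.prod_eq_zero (Finset.mem_univ i) ?_
      rw [Option.mem_def.1 hu, Option.mem_def.1 hv]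
      exact hΩ.2 u v hno.1 hno.2
    rw [codeWeight, this, mul_zero, mul_zero, mul_zero]
  · rintro ⟨T, hT, rfl⟩
    exact TrekSystem.code_mem_codeSet α β hT

end TrekSystems

/-! ### The rank bound from trek separation -/

section RankBound

variable {V : Type*} [Fintype V] [DecidableEq V] {G : MixedGraph V} {P Q A B : Finset V}

lemma exists_dirPath_of_pathMatrix_ne_zero {b : V → ℕ} (hb : ∀ i j, G.dir i j → b i < b j)
    {Λ : Matrix V V ℝ} (hΛ : Λ ∈ G.lambdaSpace) {u v : V} (huv : pathMatrix P Λ u v ≠ 0) :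
    ∃ p : G.DirPath, p.first = u ∧ p.last = v ∧ ∀ x ∈ p.verts, x ∈ P := by
  have h : ∀ i j, Λ i j ≠ 0 → b i < b j := lt_of_ne_zero hb hΛ
  induction hn : b v using Nat.strong_induction_on generalizing v with
  | _ n ih =>
    rw [pathMatrix_apply h] at huv
    have hv : v ∈ P := by by_contra hv; simp [hv] at huv
    rw [if_pos hv] at huv
    by_cases huv' : u = v
    · subst huv'
      exact ⟨⟨[u], by simp, by simp⟩, rfl, rfl, by simpa using hv⟩
    · rw [if_neg huv', zero_add] at huv
      obtain ⟨w, -, hw⟩ := Finset.exists_ne_zero_of_sum_ne_zero huv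
      have hwv : G.dir w v := by
        by_contra hd; exact right_ne_zero_of_mul hw (hΛ w v hd)
      obtain ⟨p, hp1, hp2, hp3⟩ := ih (b w) (hn ▸ hb w v hwv) (left_ne_zero_of_mul hw) rfl
      refine ⟨⟨p.verts ++ [v], by simp, List.isChain_append.2 ⟨p.chain, by simp, ?_⟩⟩, ?_, ?_, ?_⟩
      · intro x hx y hy
        rw [p.getLast?_verts] at hx
        simp only [Option.mem_def, Option.some.injEq, List.head?_cons] at hx hy
        rw [← hx, ← hy, hp2]
        exact hwv
      · rw [← hp1, DirPath.first, DirPath.first, List.head_append_of_ne_nil]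
      · simp [DirPath.last]
      · intro x hx
        rcases List.mem_append.1 hx with hx | hx
        · exact hp3 x hx
        · rw [List.mem_singleton.1 hx]; exact hv

lemma rank_add_le_rank_add_rank {m n : Type*} [Fintype m] [Fintype n] (M N : Matrix m n ℝ) :
    (M + N).rank ≤ M.rank + N.rank := by
  rw [Matrix.rank, Matrix.rank, Matrix.rank, Matrix.mulVecLin_add]
  refine (Submodule.finrank_mono ?_).trans
    (Submodule.finrank_add_le_finrank_add_finrank M.mulVecLin.range N.mulVecLin.range)
  rintro _ ⟨x, rfl⟩
  exact Submodule.add_mem_sup ⟨x, rfl⟩ ⟨x, rfl⟩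

theorem rank_restrictedSigmaSub_le {b : V → ℕ} (hb : ∀ i j, G.dir i j → b i < b j)
    {Λ Ω : Matrix V V ℝ} (hΛ : Λ ∈ G.lambdaSpace)
    (hΩ : ∀ i j, i ≠ j → ¬ G.bidir.Adj i j → Ω i j = 0) (hA : A ⊆ P) (hB : B ⊆ Q)
    {SL SR : Finset V} (hS : G.TrekSeparated P Q A B SL SR) :
    (restrictedSigmaSub hA hB Λ Ω).rank ≤ SL.card + SR.card := by
  have h : ∀ i j, Λ i j ≠ 0 → b i < b j := lt_of_ne_zero hb hΛ
  set Z := pathMatrix P Λ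
  set Z' := pathMatrix (P \ SL) Λ
  set Y := pathMatrix Q Λ
  set Y' := pathMatrix (Q \ SR) Λ
  -- Any nonzero summand of this entry would give a trek that avoids `SL` and `SR`.
  have hzero : ∀ x ∈ A, ∀ y ∈ B, (Z'.transpose * Ω * Y') x y = 0 := by
    intro x hx y hy
    by_contra hne
    rw [Matrix.mul_apply] at hne
    obtain ⟨v, -, hv⟩ := Finset.exists_ne_zero_of_sum_ne_zero hne
    have hv1 := left_ne_zero_of_mul hv
    rw [Matrix.mul_apply] at hv1
    obtain ⟨u, -, hu⟩ := Finset.exists_ne_zero_of_sum_ne_zero hv1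
    obtain ⟨p, hp1, hp2, hp3⟩ := exists_dirPath_of_pathMatrix_ne_zero hb hΛ (left_ne_zero_of_mul hu)
    obtain ⟨q, hq1, hq2, hq3⟩ := exists_dirPath_of_pathMatrix_ne_zero hb hΛ (right_ne_zero_of_mul hv)
    have htop : p.first = q.first ∨ G.bidir.Adj p.first q.first := by
      by_contra! hno
      rw [hp1, hq1] at hno
      exact right_ne_zero_of_mul hu (hΩ u v hno.1 hno.2)
    rcases hS ⟨p, q, htop⟩ ⟨fun z hz => (Finset.mem_sdiff.1 (hp3 z hz)).1,
      fun z hz => (Finset.mem_sdiff.1 (hq3 z hz)).1⟩ (hp2.symm ▸ hx : p.last ∈ A)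
      (hq2.symm ▸ hy : q.last ∈ B) with ⟨z, hz, hz'⟩ | ⟨z, hz, hz'⟩
    · exact (Finset.mem_sdiff.1 (hp3 z hz)).2 hz'
    · exact (Finset.mem_sdiff.1 (hq3 z hz)).2 hz'
  have e : restrictedSigmaSub hA hB Λ Ω =
      ((Z - Z').transpose * (Ω * Y) + (Z'.transpose * Ω) * (Y - Y')).submatrix
        (fun x : A => (x : V)) (fun y : B => (y : V)) := by
    have e' : (Z - Z').transpose * (Ω * Y) + (Z'.transpose * Ω) * (Y - Y') =
        Z.transpose * Ω * Y - Z'.transpose * Ω * Y' := by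
      rw [Matrix.transpose_sub, Matrix.sub_mul, Matrix.mul_sub, Matrix.mul_assoc Z.transpose,
        Matrix.mul_assoc Z'.transpose Ω Y]
      abel
    ext x y
    rw [e', restrictedSigmaSub_apply h, Matrix.submatrix_apply, Matrix.sub_apply,
      hzero x x.2 y y.2, sub_zero]
  rw [e]
  refine (Matrix.rank_submatrix_le _ _ _).trans ((rank_add_le_rank_add_rank _ _).trans (add_le_add ?_ ?_))
  · refine (Matrix.rank_mul_le_left _ _).trans ?_
    rw [Matrix.rank_transpose]
    exact rank_pathMatrix_sub_le h P SL
  · exact (Matrix.rank_mul_le_right _ _).trans (rank_pathMatrix_sub_le h Q SR)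

end RankBound

/-! ### Linkages from Hall's marriage theorem -/

section Linkage

/-- Menger's theorem in the form of a matching. Each element of `N` has a row and a column, there are
`k` further rows for the starts and `k` further columns for the ends of paths. A bijection that sends
the row of `v` to its own column or to that of a successor of `v`, a start to an element of `A`, and
only rows of elements of `B` to the ends, traces `k` disjoint paths from `A` to `B` (and cycles).
If `X` avoids `B`, then the elements of `A` and the successors of `X` outside of `X` separate `A` from
`B`; that all of these separators have at least `k` elements is what Hall's condition asks for. -/
theorem exists_linkage {N : Type*} [Fintype N] [DecidableEq N] (r : N → N → Prop) [DecidableRel r]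
    (A B : Finset N) (k : ℕ)
    (h : ∀ X : Finset N, Disjoint X B →
      k ≤ ((A ∪ Finset.univ.filter fun w => ∃ v ∈ X, r v w) \ X).card) :
    ∃ π : Fin k ⊕ N → N ⊕ Fin k, Function.Bijective π ∧
      (∀ i, ∃ a ∈ A, π (Sum.inl i) = Sum.inl a) ∧
      ∀ v, π (Sum.inr v) = Sum.inl v ∨ (∃ w, r v w ∧ π (Sum.inr v) = Sum.inl w) ∨
        (v ∈ B ∧ ∃ j, π (Sum.inr v) = Sum.inr j) := by
  classical
  let ρ : Fin k ⊕ N → N ⊕ Fin k → Prop := fun x c =>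
    Sum.elim (fun _ => Sum.elim (fun a => a ∈ A) (fun _ => False) c)
      (fun v => Sum.elim (fun w => v = w ∨ r v w) (fun _ => v ∈ B) c) x
  have hall : ∀ S : Finset (Fin k ⊕ N),
      S.card ≤ (Finset.univ.filter fun c => ∃ x ∈ S, ρ x c).card := by
    intro S
    rw [← Finset.card_toLeft_add_card_toRight (u := S)]
    set X := S.toRight with hX
    have hXS : ∀ v ∈ X, Sum.inr v ∈ S := fun v hv => Finset.mem_toRight.1 hv
    rcases S.toLeft.eq_empty_or_nonempty with hL | ⟨i, hi⟩
    · rw [hL, Finset.card_empty, zero_add, ← Finset.card_map (Function.Embedding.inl (β := Fin k))]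
      refine Finset.card_le_card fun c hc => ?_
      obtain ⟨v, hv, rfl⟩ := Finset.mem_map.1 hc
      exact Finset.mem_filter.2 ⟨Finset.mem_univ _, Sum.inr v, hXS v hv, Or.inl rfl⟩
    · have hk : S.toLeft.card ≤ k := by simpa using Finset.card_le_univ S.toLeft
      refine (Nat.add_le_add_right hk _).trans ?_
      by_cases hXB : Disjoint X B
      · have hT := h X hXB
        set T := (A ∪ Finset.univ.filter fun w => ∃ v ∈ X, r v w) \ X with hTdef
        refine (Nat.add_le_add_right hT _).trans ?_
        rw [← Finset.card_union_of_disjoint Finset.sdiff_disjoint,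
          ← Finset.card_map (Function.Embedding.inl (β := Fin k))]
        refine Finset.card_le_card fun c hc => ?_
        obtain ⟨w, hw, rfl⟩ := Finset.mem_map.1 hc
        refine Finset.mem_filter.2 ⟨Finset.mem_univ _, ?_⟩
        rcases Finset.mem_union.1 hw with hw | hw
        · rcases Finset.mem_union.1 (Finset.mem_sdiff.1 hw).1 with hw | hw
          · exact ⟨Sum.inl i, Finset.mem_toLeft.1 hi, hw⟩
          · obtain ⟨v, hv, hvw⟩ := (Finset.mem_filter.1 hw).2
            exact ⟨Sum.inr v, hXS v hv, Or.inr hvw⟩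
        · exact ⟨Sum.inr w, hXS w hw, Or.inl rfl⟩
      · obtain ⟨y, hyX, hyB⟩ := Finset.not_disjoint_iff.1 hXB
        have hcard : (X.disjSum (Finset.univ : Finset (Fin k))).card = k + X.card := by
          rw [Finset.card_disjSum, Finset.card_univ, Fintype.card_fin, add_comm]
        rw [← hcard]
        refine Finset.card_le_card fun c hc => Finset.mem_filter.2 ⟨Finset.mem_univ _, ?_⟩
        rcases c with v | j
        · exact ⟨Sum.inr v, hXS v (Finset.inl_mem_disjSum.1 hc), Or.inl rfl⟩
        · exact ⟨Sum.inr y, hXS y hyX, hyB⟩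
  obtain ⟨π, hinj, hρ⟩ := (Fintype.all_card_le_filter_rel_iff_exists_injective ρ).1 hall
  refine ⟨π, (Fintype.bijective_iff_injective_and_card π).2 ⟨hinj, by simp [add_comm]⟩,
    fun i => ?_, fun v => ?_⟩
  · have := hρ (Sum.inl i)
    rcases hπ : π (Sum.inl i) with a | j
    · rw [hπ] at this; exact ⟨a, this, rfl⟩
    · rw [hπ] at this; exact this.elim
  · have := hρ (Sum.inr v)
    rcases hπ : π (Sum.inr v) with w | j
    · rw [hπ] at this
      rcases this with rfl | hvw
      · exact Or.inl rfl
      · exact Or.inr (Or.inl ⟨w, hvw, rfl⟩)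
    · rw [hπ] at this
      exact Or.inr (Or.inr ⟨this, j, rfl⟩)

lemma DirPath.first_of_last {V : Type*} {G : MixedGraph V} {p : V → Prop} {S : Set V}
    (hp : ∀ u v, G.dir u v → u ∈ S → v ∈ S → p v → p u)
    (q : G.DirPath) (hq : ∀ x ∈ q.verts, x ∈ S) (hl : p q.last) : p q.first := by
  obtain ⟨l, hne, hch⟩ := q
  induction l with
  | nil => exact absurd rfl hne
  | cons x l ih =>
    cases l with
    | nil => exact hl
    | cons y l =>
      rw [List.isChain_cons_cons] at hch
      refine hp x y hch.1 (hq x (by simp)) (hq y (by simp)) (ih (by simp) hch.2 ?_ ?_)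
      · exact fun z hz => hq z (List.mem_cons_of_mem _ hz)
      · simpa [DirPath.last] using hl

lemma DirPath.last_of_first {V : Type*} {G : MixedGraph V} {p : V → Prop} {S : Set V}
    (hp : ∀ u v, G.dir u v → u ∈ S → v ∈ S → p u → p v)
    (q : G.DirPath) (hq : ∀ x ∈ q.verts, x ∈ S) (hf : p q.first) : p q.last := by
  by_contra hl
  exact DirPath.first_of_last (p := fun v => ¬ p v) (S := S)
    (fun u v huv hu hv hpv hpu => hpv (hp u v huv hu hv hpu)) q hq hl hf

variable {V : Type*} [Fintype V] [DecidableEq V] {G : MixedGraph V} {P Q A B : Finset V}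

/-- If the support of `Λ` consists of disjoint paths inside `P` from the `t i` to the `c j`, with unit
weights, then the path matrix from the `t i` to the `c j` is nonsingular. The hypothesis `hc` says that
every vertex is an end, lies outside of `P`, is neither a start nor preceded by another vertex, or is
followed by a vertex of `P` that is no start and has no other predecessor. -/
lemma det_pathMatrix_ne_zero {b : V → ℕ} {Λ : Matrix V V ℝ} (h : ∀ i j, Λ i j ≠ 0 → b i < b j)
    {k : ℕ} {t c : Fin k → V} (ht : Function.Injective t) (htP : ∀ i, t i ∈ P)
    (hΛt : ∀ i w, Λ w (t i) = 0)
    (hc : ∀ v, (∃ j, c j = v) ∨ v ∉ P ∨ ((∀ i, t i ≠ v) ∧ ∀ w, Λ w v = 0) ∨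
      ∃ v', b v < b v' ∧ v' ∈ P ∧ (∀ i, t i ≠ v') ∧ Λ v v' = 1 ∧ ∀ w, w ≠ v → Λ w v' = 0) :
    (Matrix.of fun i j => pathMatrix P Λ (t i) (c j)).det ≠ 0 := by
  intro hdet
  obtain ⟨z, hz0, hz⟩ := Matrix.exists_vecMul_eq_zero_iff.2 hdet
  set y : V → ℝ := fun v => ∑ i, z i * pathMatrix P Λ (t i) v with hy
  have hyrec : ∀ v ∈ P, y v = (∑ i, if t i = v then z i else 0) + ∑ w, y w * Λ w v := by
    intro v hv
    simp only [hy, Finset.sum_mul]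
    rw [Finset.sum_comm, ← Finset.sum_add_distrib]
    refine Finset.sum_congr rfl fun i _ => ?_
    rw [pathMatrix_apply h P (t i) v, if_pos hv, mul_add, Finset.mul_sum]
    simp only [mul_assoc, mul_ite, mul_one, mul_zero]
  -- The combination `y` is constant along the paths and vanishes at their ends.
  have hy0 : ∀ v, y v = 0 := by
    intro v
    induction hn : (Finset.univ.sup b) - b v using Nat.strong_induction_on generalizing v with
    | _ n ih =>
      rcases hc v with ⟨j, rfl⟩ | hv | ⟨hvt, hvΛ⟩ | ⟨v', hbv, hv'P, hv't, hone, hzero⟩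
      · have := congrFun hz j
        simpa [Matrix.vecMul, dotProduct] using this
      · refine Finset.sum_eq_zero fun i _ => ?_
        rw [pathMatrix_apply h P (t i) v, if_neg hv, mul_zero]
      · by_cases hv : v ∈ P
        · rw [hyrec v hv]
          simp [hvt, hvΛ]
        · refine Finset.sum_eq_zero fun i _ => ?_
          rw [pathMatrix_apply h P (t i) v, if_neg hv, mul_zero]
      · have hle : b v' ≤ Finset.univ.sup b := Finset.le_sup (Finset.mem_univ v')
        have h1 := ih _ (by omega) v' rfl
        rw [hyrec v' hv'P, Finset.sum_eq_zero (fun i _ => if_neg (hv't i)), zero_add,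
          Finset.sum_eq_single v (fun w _ hw => by rw [hzero w hw, mul_zero]) (by simp), hone,
          mul_one] at h1
        exact h1
  refine hz0 (funext fun i => ?_)
  have h1 := hyrec (t i) (htP i)
  rw [hy0, Finset.sum_eq_single i (fun j _ hj => if_neg (ht.ne hj)) (by simp), if_pos rfl,
    Finset.sum_eq_zero (fun w _ => by rw [hΛt i w, mul_zero]), add_zero] at h1
  exact h1.symm

/-- The successor relation of the graph in which the treks are the paths: `inl v` is the left copy of
`v`, from which a trek climbs against the directed edges inside `P`, and `inr w` is the right copy,
from which it descends inside `Q`. -/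
def trekStep (G : MixedGraph V) (P Q : Finset V) : V ⊕ V → V ⊕ V → Prop
  | Sum.inl v, Sum.inl u => G.dir u v ∧ u ∈ P ∧ v ∈ P
  | Sum.inl v, Sum.inr w => (v = w ∨ G.bidir.Adj v w) ∧ v ∈ P ∧ w ∈ Q
  | Sum.inr _, Sum.inl _ => False
  | Sum.inr w, Sum.inr z => G.dir w z ∧ w ∈ Q ∧ z ∈ Q

/-- A set of sided vertices that contains no end in `B` yields a separating pair. -/
lemma trekSeparated_of_disjoint [DecidableRel (trekStep G P Q)] {X : Finset (V ⊕ V)}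
    (hX : Disjoint X (B.map Function.Embedding.inr)) {S : Finset (V ⊕ V)}
    (hS : S = (A.map Function.Embedding.inl ∪
      Finset.univ.filter fun w => ∃ v ∈ X, trekStep G P Q v w) \ X) :
    G.TrekSeparated P Q A B S.toLeft S.toRight := by
  intro τ hτ hsource htarget
  by_contra! hno
  have hL : ∀ x ∈ τ.left.verts, Sum.inl x ∉ S := fun x hx hxS =>
    (Set.eq_empty_iff_forall_notMem.1 hno.1 x) ⟨hx, by simpa using hxS⟩
  have hR : ∀ x ∈ τ.right.verts, Sum.inr x ∉ S := fun x hx hxS =>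
    (Set.eq_empty_iff_forall_notMem.1 hno.2 x) ⟨hx, by simpa using hxS⟩
  have hstep : ∀ v ∈ X, ∀ w, trekStep G P Q v w → w ∉ S → w ∈ X := by
    intro v hv w hvw hw
    by_contra hwX
    exact hw (by
      rw [hS]
      exact Finset.mem_sdiff.2 ⟨Finset.mem_union_right _
        (Finset.mem_filter.2 ⟨Finset.mem_univ _, v, hv, hvw⟩), hwX⟩)
  have hlast : Sum.inl τ.left.last ∈ X := by
    by_contra hX'
    refine hL _ (List.getLast_mem τ.left.ne_nil) ?_
    rw [hS]
    exact Finset.mem_sdiff.2 ⟨Finset.mem_union_left _ (Finset.mem_map_of_mem _ hsource), hX'⟩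
  have hfirst : Sum.inl τ.left.first ∈ X :=
    DirPath.first_of_last (p := fun v => Sum.inl v ∈ X) (S := {x | x ∈ P ∧ Sum.inl x ∉ S})
      (fun u v huv hu hv hvX => hstep _ hvX _ ⟨huv, hu.1, hv.1⟩ hu.2) τ.left
      (fun x hx => ⟨hτ.1 hx, hL x hx⟩) hlast
  have hfirst' : Sum.inr τ.right.first ∈ X :=
    hstep _ hfirst _ ⟨τ.top, hτ.1 (List.head_mem _), hτ.2 (List.head_mem _)⟩ (hR _ (List.head_mem _))
  have hlast' : Sum.inr τ.right.last ∈ X :=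
    DirPath.last_of_first (p := fun v => Sum.inr v ∈ X) (S := {x | x ∈ Q ∧ Sum.inr x ∉ S})
      (fun u v huv hu hv huX => hstep _ huX _ ⟨huv, hu.1, hv.1⟩ hv.2) τ.right
      (fun x hx => ⟨hτ.2 hx, hR x hx⟩) hfirst'
  exact Finset.disjoint_left.1 hX hlast' (Finset.mem_map_of_mem _ htarget)

/-- If every separating pair has size at least `k`, then there are `k` tops from which disjoint left
paths lead to `A` and disjoint right paths lead to `B`. The disjointness is recorded by the
nonsingularity of the path matrices of two choices of edge weights, one for each side. -/
theorem exists_tops {b : V → ℕ} (hb : ∀ i j, G.dir i j → b i < b j) {k : ℕ}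
    (hk : ∀ SL SR, G.TrekSeparated P Q A B SL SR → k ≤ SL.card + SR.card) :
    ∃ (α : Fin k → A) (β : Fin k → B) (tL tR : Fin k → V), ∃ ΛL ∈ G.lambdaSpace,
      ∃ ΛR ∈ G.lambdaSpace, (∀ i, tL i = tR i ∨ G.bidir.Adj (tL i) (tR i)) ∧
      (Matrix.of fun i j => pathMatrix P ΛL (tL i) (α j)).det ≠ 0 ∧
      (Matrix.of fun i j => pathMatrix Q ΛR (tR i) (β j)).det ≠ 0 := by
  classical
  obtain ⟨π, ⟨hinj, hsurj⟩, hstart, hstep⟩ := exists_linkage (trekStep G P Q)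
    (A.map Function.Embedding.inl) (B.map Function.Embedding.inr) k fun X hX => by
      have := hk _ _ (trekSeparated_of_disjoint hX rfl)
      rwa [Finset.card_toLeft_add_card_toRight] at this
  have hα : ∀ i, ∃ a : A, π (Sum.inl i) = Sum.inl (Sum.inl (a : V)) := by
    intro i
    obtain ⟨a, ha, hi⟩ := hstart i
    obtain ⟨x, hx, rfl⟩ := Finset.mem_map.1 ha
    exact ⟨⟨x, hx⟩, hi⟩
  choose α hα using hα
  -- The three possible images of a left row and of a right row.
  have hleft : ∀ v, π (Sum.inr (Sum.inl v)) = Sum.inl (Sum.inl v) ∨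
      (∃ u, (G.dir u v ∧ u ∈ P ∧ v ∈ P) ∧ π (Sum.inr (Sum.inl v)) = Sum.inl (Sum.inl u)) ∨
      ∃ w, ((v = w ∨ G.bidir.Adj v w) ∧ v ∈ P ∧ w ∈ Q) ∧
        π (Sum.inr (Sum.inl v)) = Sum.inl (Sum.inr w) := by
    intro v
    rcases hstep (Sum.inl v) with h | ⟨u | w, hw, h⟩ | ⟨hB, -⟩
    · exact Or.inl h
    · exact Or.inr (Or.inl ⟨u, hw, h⟩)
    · exact Or.inr (Or.inr ⟨w, hw, h⟩)
    · simp at hB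
  have hright : ∀ w, π (Sum.inr (Sum.inr w)) = Sum.inl (Sum.inr w) ∨
      (∃ z, (G.dir w z ∧ w ∈ Q ∧ z ∈ Q) ∧ π (Sum.inr (Sum.inr w)) = Sum.inl (Sum.inr z)) ∨
      w ∈ B ∧ ∃ j, π (Sum.inr (Sum.inr w)) = Sum.inr j := by
    intro w
    rcases hstep (Sum.inr w) with h | ⟨u | z, hw, h⟩ | ⟨hB, hj⟩
    · exact Or.inl h
    · exact hw.elim
    · exact Or.inr (Or.inl ⟨z, hw, h⟩)
    · exact Or.inr (Or.inr ⟨by simpa using hB, hj⟩)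
  have hβ : ∀ j, ∃ y : B, π (Sum.inr (Sum.inr (y : V))) = Sum.inr j := by
    intro j
    obtain ⟨i | v | w, hx⟩ := hsurj (Sum.inr j)
    · rw [hα i] at hx; cases hx
    · rcases hleft v with h | ⟨u, -, h⟩ | ⟨w, -, h⟩ <;> rw [h] at hx <;> cases hx
    · rcases hright w with h | ⟨z, -, h⟩ | ⟨hB, -⟩
      · rw [h] at hx; cases hx
      · rw [h] at hx; cases hx
      · exact ⟨⟨w, hB⟩, hx⟩
  choose β hβ using hβ
  -- `W` consists of the right ends of the tops; counting columns shows that it has `k` elements.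
  set W : Finset V := Finset.univ.filter fun w =>
    ∃ v, π (Sum.inr (Sum.inl v)) = Sum.inl (Sum.inr w) with hW
  have hcard : W.card = k := by
    have himage : (Finset.univ : Finset (Fin k ⊕ V)).image
        (fun x => π (Sum.map id Sum.inl x)) =
        (((Finset.univ : Finset V).disjSum W).map Function.Embedding.inl :
          Finset ((V ⊕ V) ⊕ Fin k)) := by
      ext c
      simp only [Finset.mem_image, Finset.mem_univ, true_and, Finset.mem_map]
      constructor
      · rintro ⟨i | v, rfl⟩
        · exact ⟨Sum.inl (α i), by simp, (hα i).symm⟩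
        · rcases hleft v with h | ⟨u, -, h⟩ | ⟨w, -, h⟩
          · exact ⟨Sum.inl v, by simp, h.symm⟩
          · exact ⟨Sum.inl u, by simp, h.symm⟩
          · exact ⟨Sum.inr w, by simpa [hW] using ⟨v, h⟩, h.symm⟩
      · rintro ⟨v | w, hw, rfl⟩
        · obtain ⟨i | u | w, hx⟩ := hsurj (Sum.inl (Sum.inl v))
          · exact ⟨Sum.inl i, hx⟩
          · exact ⟨Sum.inr u, hx⟩
          · rcases hright w with h | ⟨z, -, h⟩ | ⟨-, j, h⟩ <;> rw [h] at hx <;> cases hx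
        · obtain ⟨v, hv⟩ := (Finset.mem_filter.1 (Finset.inr_mem_disjSum.1 hw)).2
          exact ⟨Sum.inr v, hv⟩
    have hinj' : Function.Injective fun x : Fin k ⊕ V => π (Sum.map id Sum.inl x) :=
      hinj.comp (Function.injective_id.sumMap Sum.inl_injective)
    have := congrArg Finset.card himage
    rw [Finset.card_image_of_injective _ hinj', Finset.card_map, Finset.card_disjSum,
      Finset.card_univ, Fintype.card_sum, Fintype.card_fin, Finset.card_univ] at this
    omega
  let e : Fin k ≃ W := (W.equivFinOfCardEq hcard).symm
  have htL : ∀ i, ∃ v, π (Sum.inr (Sum.inl v)) = Sum.inl (Sum.inr (e i : V)) :=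
    fun i => (Finset.mem_filter.1 (e i).2).2
  choose tL htL using htL
  have htop : ∀ i, (tL i = e i ∨ G.bidir.Adj (tL i) (e i)) ∧ tL i ∈ P ∧ (e i : V) ∈ Q := by
    intro i
    rcases hleft (tL i) with h | ⟨u, -, h⟩ | ⟨w, hw, h⟩
    · rw [htL i] at h; cases h
    · rw [htL i] at h; cases h
    · rw [htL i] at h; cases h; exact hw
  have heinj : Function.Injective fun i => (e i : V) := Subtype.val_injective.comp e.injective
  have htLinj : Function.Injective tL := fun i j hij => by
    have h1 := htL i
    rw [hij, htL j] at h1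
    exact heinj (Sum.inr_injective (Sum.inl_injective h1)).symm
  set ΛL : Matrix V V ℝ := Matrix.of fun u v =>
    if u ≠ v ∧ π (Sum.inr (Sum.inl v)) = Sum.inl (Sum.inl u) then 1 else 0 with hΛLdef
  set ΛR : Matrix V V ℝ := Matrix.of fun w z =>
    if w ≠ z ∧ π (Sum.inr (Sum.inr w)) = Sum.inl (Sum.inr z) then 1 else 0 with hΛRdef
  have hΛL : ∀ u v, u ≠ v → π (Sum.inr (Sum.inl v)) = Sum.inl (Sum.inl u) →
      G.dir u v ∧ u ∈ P ∧ v ∈ P := by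
    intro u v huv h
    rcases hleft v with h' | ⟨u', hu', h'⟩ | ⟨w, -, h'⟩
    · rw [h] at h'; cases h'; exact absurd rfl huv
    · rw [h] at h'; cases h'; exact hu'
    · rw [h] at h'; cases h'
  have hΛR : ∀ w z, w ≠ z → π (Sum.inr (Sum.inr w)) = Sum.inl (Sum.inr z) →
      G.dir w z ∧ w ∈ Q ∧ z ∈ Q := by
    intro w z hwz h
    rcases hright w with h' | ⟨z', hz', h'⟩ | ⟨-, j, h'⟩
    · rw [h] at h'; cases h'; exact absurd rfl hwz
    · rw [h] at h'; cases h'; exact hz'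
    · rw [h] at h'; cases h'
  have hmL : ΛL ∈ G.lambdaSpace := fun u v huv =>
    if_neg fun h => huv (hΛL u v h.1 h.2).1
  have hmR : ΛR ∈ G.lambdaSpace := fun w z hwz =>
    if_neg fun h => hwz (hΛR w z h.1 h.2).1
  refine ⟨α, β, tL, fun i => e i, ΛL, hmL, ΛR, hmR, fun i => (htop i).1, ?_, ?_⟩
  · refine det_pathMatrix_ne_zero (lt_of_ne_zero hb hmL) htLinj (fun i => (htop i).2.1) (fun i w => ?_) fun v => ?_
    · refine if_neg fun h => ?_
      rw [htL i] at h
      cases h.2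
    -- Follow the path from `v` towards `A`: look at the row that is matched to the left column of `v`.
    · obtain ⟨i | v' | w, hx⟩ := hsurj (Sum.inl (Sum.inl v))
      · rw [hα i] at hx
        cases hx
        exact Or.inl ⟨i, rfl⟩
      · rcases eq_or_ne v v' with rfl | hne
        · refine Or.inr (Or.inr (Or.inl ⟨fun i hi => ?_, fun w => if_neg fun h => ?_⟩))
          · have := htL i
            rw [hi, hx] at this
            cases this
          · rw [hx] at h
            exact h.1 (Sum.inl_injective (Sum.inl_injective h.2)).symm
        · obtain ⟨hd, -, hP⟩ := hΛL v v' hne hx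
          refine Or.inr (Or.inr (Or.inr ⟨v', hb _ _ hd, hP, fun i hi => ?_, if_pos ⟨hne, hx⟩,
            fun w hw => if_neg fun h => ?_⟩))
          · have := htL i
            rw [hi, hx] at this
            cases this
          · rw [hx] at h
            exact hw (Sum.inl_injective (Sum.inl_injective h.2)).symm
      · rcases hright w with h | ⟨z, -, h⟩ | ⟨-, j, h⟩ <;> rw [h] at hx <;> cases hx
  · have hnotR : ∀ i w, π (Sum.inr (Sum.inr w)) ≠ Sum.inl (Sum.inr (e i : V)) := by
      intro i w h
      have := hinj (h.trans (htL i).symm)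
      cases this
    refine det_pathMatrix_ne_zero (lt_of_ne_zero hb hmR) heinj (fun i => (htop i).2.2)
      (fun i w => if_neg fun h => hnotR i w h.2) fun v => ?_
    rcases hright v with h | ⟨z, ⟨hd, -, hQ⟩, h⟩ | ⟨-, j, h⟩
    · refine Or.inr (Or.inr (Or.inl ⟨fun i hi => hnotR i v (hi ▸ h), fun w => if_neg fun h' => ?_⟩))
      have := hinj (h'.2.trans h.symm)
      exact h'.1 (Sum.inr_injective (Sum.inr_injective this))
    · have hne : v ≠ z := by rintro rfl; exact lt_irrefl _ (hb _ _ hd)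
      refine Or.inr (Or.inr (Or.inr ⟨z, hb _ _ hd, hQ, fun i hi => hnotR i v (hi ▸ h),
        if_pos ⟨hne, h⟩, fun w hw => if_neg fun h' => ?_⟩))
      have := hinj (h'.2.trans h.symm)
      exact hw (Sum.inr_injective (Sum.inr_injective this))
    · have := hinj ((hβ j).trans h.symm)
      exact Or.inl ⟨j, Sum.inr_injective (Sum.inr_injective this)⟩

end Linkage

/-! ### Generic rank -/

section GenericRank

open Polynomial in
lemma exists_pos_eval_ne_zero {p : ℝ[X]} (hp : p ≠ 0) : ∃ t > 0, p.eval t ≠ 0 := by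
  by_contra! h
  exact hp (p.eq_zero_of_infinite_isRoot ((Set.Ioi_infinite (0 : ℝ)).mono fun t ht => h t ht))

/-- The polynomial matrix that parametrizes the line through `M` and `N`. -/
noncomputable def linePoly {m n : Type*} (M N : Matrix m n ℝ) : Matrix m n (Polynomial ℝ) :=
  Matrix.of fun i j => Polynomial.C (M i j) + Polynomial.X * Polynomial.C (N i j - M i j)

lemma map_linePoly {m n : Type*} (M N : Matrix m n ℝ) (t : ℝ) :
    (linePoly M N).map (Polynomial.evalRingHom t) = M + t • (N - M) := by
  ext i j
  simp [linePoly]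

lemma add_smul_sub_mem_lambdaSpace {V : Type*} {G : MixedGraph V} {Λ Λ' : Matrix V V ℝ}
    (h : Λ ∈ G.lambdaSpace) (h' : Λ' ∈ G.lambdaSpace) (t : ℝ) : Λ + t • (Λ' - Λ) ∈ G.lambdaSpace := fun i j hij => by
  simp [h i j hij, h' i j hij]

variable {V : Type*} [Fintype V] [DecidableEq V] {R S : Type*} [CommRing R] [CommRing S] {k : ℕ}

/-- The determinant of the path matrix inside `P` from combinations of vertices, given by the columns
of `F`, to the vertices `α j`. -/
def sideDet (P : Finset V) (α : Fin k → V) (Λ : Matrix V V R) (F : Matrix V (Fin k) R) : R :=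
  ((F.transpose * pathMatrix P Λ).submatrix id α).det

/-- The minor of `Σ^{(P,Q)}` with rows `α` and columns `β`, as a polynomial expression. -/
def sigmaMinor (P Q : Finset V) (α β : Fin k → V) (Λ Ω : Matrix V V R) : R :=
  (((pathMatrix P Λ).transpose * Ω * pathMatrix Q Λ).submatrix α β).det

lemma map_sideDet (φ : R →+* S) (P : Finset V) (α : Fin k → V) (Λ : Matrix V V R)
    (F : Matrix V (Fin k) R) : φ (sideDet P α Λ F) = sideDet P α (Λ.map φ) (F.map φ) := by
  rw [sideDet, sideDet, RingHom.map_det, RingHom.mapMatrix_apply, ← Matrix.submatrix_map,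
    Matrix.map_mul, map_pathMatrix, Matrix.transpose_map]

lemma map_sigmaMinor (φ : R →+* S) (P Q : Finset V) (α β : Fin k → V) (Λ Ω : Matrix V V R) :
    φ (sigmaMinor P Q α β Λ Ω) = sigmaMinor P Q α β (Λ.map φ) (Ω.map φ) := by
  rw [sigmaMinor, sigmaMinor, RingHom.map_det, RingHom.mapMatrix_apply, ← Matrix.submatrix_map,
    Matrix.map_mul, Matrix.map_mul, map_pathMatrix, Matrix.transpose_map, map_pathMatrix]

lemma sigmaMinor_mul_transpose (P Q : Finset V) (α β : Fin k → V) (Λ : Matrix V V R)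
    (F : Matrix V (Fin k) R) :
    sigmaMinor P Q α β Λ (F * F.transpose) = sideDet P α Λ F * sideDet Q β Λ F := by
  rw [sideDet, sideDet, ← Matrix.det_transpose ((F.transpose * pathMatrix P Λ).submatrix id α),
    ← Matrix.det_mul, sigmaMinor]
  congr 1
  rw [Matrix.transpose_submatrix, Matrix.transpose_mul, Matrix.transpose_transpose,
    ← Matrix.submatrix_mul _ _ α id β Function.bijective_id]
  simp only [Matrix.mul_assoc]

variable {G : MixedGraph V} {P Q A B : Finset V}

lemma sideDet_single (P : Finset V) (α t : Fin k → V) (Λ : Matrix V V R) :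
    sideDet P α Λ (Matrix.of fun u i => if u = t i then 1 else 0) =
      (Matrix.of fun i j => pathMatrix P Λ (t i) (α j)).det := by
  rw [sideDet]
  congr 1
  ext i j
  simp [Matrix.mul_apply]

/-- If no separating pair has size less than `k`, some `k × k` minor does not vanish identically. For
given tops `tL i`, `tR i`, take `Ω = F Fᵀ` where the `i`-th column of `F` is supported on
`{tL i, tR i}`: the minor becomes a product of one factor for the left sides and one for the right
sides. Each factor is nonzero somewhere on a line in the parameter space, hence both are nonzero at a
common point. A small multiple of the identity makes `Ω` positive definite. -/
theorem exists_sigmaMinor_ne_zero {b : V → ℕ} (hb : ∀ i j, G.dir i j → b i < b j)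
    (hk : ∀ SL SR, G.TrekSeparated P Q A B SL SR → k ≤ SL.card + SR.card) :
    ∃ (α : Fin k → A) (β : Fin k → B), ∃ Λ ∈ G.lambdaSpace, ∃ Ω ∈ G.omegaSpace,
      sigmaMinor P Q (fun i => (α i : V)) (fun j => (β j : V)) Λ Ω ≠ 0 := by
  obtain ⟨α, β, tL, tR, ΛL, hΛL, ΛR, hΛR, htop, hL, hR⟩ := exists_tops hb hk
  refine ⟨α, β, ?_⟩
  set α' : Fin k → V := fun i => α i
  set β' : Fin k → V := fun j => β j
  set FL : Matrix V (Fin k) ℝ := Matrix.of fun u i => if u = tL i then 1 else 0 with hFL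
  set FR : Matrix V (Fin k) ℝ := Matrix.of fun u i => if u = tR i then 1 else 0 with hFR
  obtain ⟨t, ht⟩ : ∃ t : ℝ, sideDet P α' (ΛL + t • (ΛR - ΛL)) (FL + t • (FR - FL)) *
      sideDet Q β' (ΛL + t • (ΛR - ΛL)) (FL + t • (FR - FL)) ≠ 0 := by
    have hev : ∀ (t : ℝ) (P : Finset V) (α : Fin k → V),
        (sideDet P α (linePoly ΛL ΛR) (linePoly FL FR)).eval t =
          sideDet P α (ΛL + t • (ΛR - ΛL)) (FL + t • (FR - FL)) := by
      intro t P α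
      rw [← Polynomial.coe_evalRingHom, map_sideDet, map_linePoly, map_linePoly]
    have h0 : sideDet P α' (linePoly ΛL ΛR) (linePoly FL FR) ≠ 0 := by
      intro h0
      have := hev 0 P α'
      rw [h0, Polynomial.eval_zero, zero_smul, zero_smul, add_zero, add_zero, sideDet_single] at this
      exact hL this.symm
    have h1 : sideDet Q β' (linePoly ΛL ΛR) (linePoly FL FR) ≠ 0 := by
      intro h1
      have := hev 1 Q β'
      rw [h1, Polynomial.eval_zero, one_smul, one_smul, add_sub_cancel, add_sub_cancel,
        sideDet_single] at this
      exact hR this.symm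
    obtain ⟨t, -, ht⟩ := exists_pos_eval_ne_zero (mul_ne_zero h0 h1)
    rw [Polynomial.eval_mul, hev, hev] at ht
    exact ⟨t, ht⟩
  set Λ := ΛL + t • (ΛR - ΛL)
  set F := FL + t • (FR - FL) with hF
  have hΛ : Λ ∈ G.lambdaSpace := add_smul_sub_mem_lambdaSpace hΛL hΛR t
  rw [← sigmaMinor_mul_transpose] at ht
  obtain ⟨s, hs, hs'⟩ : ∃ s : ℝ, s > 0 ∧
      sigmaMinor P Q α' β' Λ (F * F.transpose + s • (1 : Matrix V V ℝ)) ≠ 0 := by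
    have hev : ∀ s : ℝ, (sigmaMinor P Q α' β' (linePoly Λ Λ)
        (linePoly (F * F.transpose) (F * F.transpose + 1))).eval s =
          sigmaMinor P Q α' β' Λ (F * F.transpose + s • (1 : Matrix V V ℝ)) := by
      intro s
      rw [← Polynomial.coe_evalRingHom, map_sigmaMinor, map_linePoly, map_linePoly, sub_self,
        smul_zero, add_zero, add_sub_cancel_left]
    have h0 : sigmaMinor P Q α' β' (linePoly Λ Λ)
        (linePoly (F * F.transpose) (F * F.transpose + 1)) ≠ 0 := by
      intro h0
      have := hev 0
      rw [h0, Polynomial.eval_zero, zero_smul, add_zero] at this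
      exact ht this.symm
    obtain ⟨s, hs, hs'⟩ := exists_pos_eval_ne_zero h0
    exact ⟨s, hs, by rwa [hev] at hs'⟩
  refine ⟨Λ, hΛ, _, ⟨?_, fun u v huv hadj => ?_⟩, hs'⟩
  · have h1 : (F * F.transpose).PosSemidef := by
      simpa using Matrix.posSemidef_self_mul_conjTranspose F
    exact Matrix.PosDef.posSemidef_add h1 (Matrix.PosDef.one.smul hs)
  · have hFsupp : ∀ u i, F u i ≠ 0 → u = tL i ∨ u = tR i := by
      intro u i hne
      by_contra! hno
      exact hne (by simp [hF, hFL, hFR, hno.1, hno.2])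
    have hzero : (F * F.transpose) u v = 0 := by
      rw [Matrix.mul_apply]
      refine Finset.sum_eq_zero fun i _ => ?_
      by_contra hne
      have hu := hFsupp u i (left_ne_zero_of_mul hne)
      have hv := hFsupp v i (right_ne_zero_of_mul hne)
      have := htop i
      rcases hu with rfl | rfl <;> rcases hv with rfl | rfl
      · exact huv rfl
      · exact this.elim huv hadj
      · exact this.elim (fun h => huv h.symm) fun h => hadj h.symm
      · exact huv rfl
    simp [hzero, Matrix.one_apply_ne huv]

/-- A nonvanishing `k × k` minor bounds the rank from below. -/
lemma le_rank_of_sigmaMinor_ne_zero {b : V → ℕ} {Λ Ω : Matrix V V ℝ}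
    (h : ∀ i j, Λ i j ≠ 0 → b i < b j) (hA : A ⊆ P) (hB : B ⊆ Q) {α : Fin k → A} {β : Fin k → B}
    (hne : sigmaMinor P Q (fun i => (α i : V)) (fun j => (β j : V)) Λ Ω ≠ 0) :
    k ≤ (restrictedSigmaSub hA hB Λ Ω).rank := by
  have e : (restrictedSigmaSub hA hB Λ Ω).submatrix α β =
      ((pathMatrix P Λ).transpose * Ω * pathMatrix Q Λ).submatrix (fun i => (α i : V))
        fun j => (β j : V) := by
    ext i j
    rw [Matrix.submatrix_apply, restrictedSigmaSub_apply h, Matrix.submatrix_apply]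
  calc k = ((restrictedSigmaSub hA hB Λ Ω).submatrix α β).rank := by
        rw [Matrix.rank_of_isUnit _ ((Matrix.isUnit_iff_isUnit_det _).2 (by
          rw [e]; exact isUnit_iff_ne_zero.2 hne)), Fintype.card_fin]
    _ ≤ _ := Matrix.rank_submatrix_le _ _ _

end GenericRank

end MixedGraph

theorem theorem4p3 {V : Type*} [Fintype V] [DecidableEq V] (G : MixedGraph V) (hG : G.Acyclic)
    (P Q A B : Finset V) (hA : A ⊆ P) (hB : B ⊆ Q) :
    (∃ m : ℕ,
      IsLeast {k : ℕ | ∃ SL SR : Finset V, G.TrekSeparated P Q A B SL SR ∧ k = SL.card + SR.card} m ∧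
      (∀ Λ ∈ G.lambdaSpace, ∀ Ω ∈ G.omegaSpace,
        (MixedGraph.restrictedSigmaSub hA hB Λ Ω).rank ≤ m) ∧
      G.Generically fun Λ Ω => (MixedGraph.restrictedSigmaSub hA hB Λ Ω).rank = m) ∧
    (A.card = B.card →
      (G.restrictedSystems P Q A B).Finite ∧
      ∀ Λ ∈ G.lambdaSpace, ∀ Ω ∈ G.omegaSpace,
      ∀ (α : Fin A.card ≃ A) (β : Fin A.card ≃ B),
        ((MixedGraph.restrictedSigmaSub hA hB Λ Ω).submatrix α β).det =
          ∑ᶠ T ∈ G.restrictedSystems P Q A B, ((T.sign α β : ℤ) : ℝ) * T.monomial Λ Ω) := by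
  classical
  obtain ⟨b, hb⟩ := hG.exists_height
  refine ⟨?_, fun hcard => ⟨?_, fun Λ hΛ Ω hΩ α β =>
    MixedGraph.det_restrictedSigmaSub hb hΛ hΩ hA hB α β⟩⟩
  · have hne : ∃ k, ∃ SL SR : Finset V, G.TrekSeparated P Q A B SL SR ∧ k = SL.card + SR.card :=
      ⟨_, A, ∅, fun τ _ hs _ => Or.inl ⟨τ.source, List.getLast_mem τ.left.ne_nil, hs⟩, rfl⟩
    have hleast := Nat.isLeast_find hne
    refine ⟨Nat.find hne, hleast, ?_⟩
    have hle : ∀ Λ ∈ G.lambdaSpace, ∀ Ω ∈ G.omegaSpace,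
        (MixedGraph.restrictedSigmaSub hA hB Λ Ω).rank ≤ Nat.find hne := by
      intro Λ hΛ Ω hΩ
      obtain ⟨SL, SR, hS, hm⟩ := hleast.1
      rw [hm]
      exact MixedGraph.rank_restrictedSigmaSub_le hb hΛ hΩ.2 hA hB hS
    refine ⟨hle, ?_⟩
    obtain ⟨α, β, Λ₀, hΛ₀, Ω₀, hΩ₀, hne₀⟩ := MixedGraph.exists_sigmaMinor_ne_zero hb
      fun SL SR hS => hleast.2 ⟨SL, SR, hS, rfl⟩
    set α' : Fin (Nat.find hne) → V := fun i => α i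
    set β' : Fin (Nat.find hne) → V := fun j => β j
    set f : MvPolynomial ((V × V) ⊕ (V × V)) ℝ := MixedGraph.sigmaMinor P Q α' β'
      (Matrix.of fun i j => MvPolynomial.X (Sum.inl (i, j)))
      (Matrix.of fun i j => MvPolynomial.X (Sum.inr (i, j)))
    have hf : ∀ Λ Ω : Matrix V V ℝ,
        MvPolynomial.eval (Sum.elim (fun e => Λ e.1 e.2) (fun e => Ω e.1 e.2)) f =
          MixedGraph.sigmaMinor P Q α' β' Λ Ω := by
      intro Λ Ω
      rw [MixedGraph.map_sigmaMinor]
      congr 1 <;> ext i j <;> simp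
    refine ⟨f, ⟨Λ₀, hΛ₀, Ω₀, hΩ₀, by rwa [hf]⟩, fun Λ hΛ Ω hΩ hfne => ?_⟩
    rw [hf] at hfne
    exact le_antisymm (hle Λ hΛ Ω hΩ)
      (MixedGraph.le_rank_of_sigmaMinor_ne_zero (MixedGraph.lt_of_ne_zero hb hΛ) hA hB hfne)
  · exact MixedGraph.finite_restrictedSystems hb A.equivFin.symm (B.equivFinOfCardEq hcard.symm).symm
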